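/- **Setting.** Let $\beta>0$ and $\Delta=E_0-E>0$. A three-level system with Hamiltonian $H_S=\mathrm{diag}(E_0,E,E)$ in the orthonormal basis $\varphi_1,\varphi_2,\varphi_3$ of $\mathbb C^3$ (the degenerate case $\sigma=0$ of $H_S(\sigma)=\mathrm{diag}(E_0,E+\sigma/2,E-\sigma/2)$) is coupled, with coupling constant $\lambda\neq0$, to a bosonic heat bath at inverse temperature $\beta$ through $\lambda\, G\otimes\varphi(g)$, where $G=\sum_{j=2,3}(|\varphi_1\rangle\langle\varphi_j|+|\varphi_j\rangle\langle\varphi_1|)$ and $g\in L^2(\mathbb R^3)$. Let $J(\omega)=\frac{\pi}{2}\omega^2\int_{S^2}|g(\omega,\Sigma)|^2d\Sigma$ be the spectral density. Assume that $\int_{\mathbb R^3}|g(k)|^2|k|^{-1}d^3k<\infty$, that $J$ is continuously differentiable in a neighbourhood of $\Delta$, and that $J(\Delta)>0$. *Liouville operator.* Let $\mathcal F$ be the symmetric Fock space over $L^2(\mathbb R\times S^2,du\,d\Sigma)$ with vacuum $\Omega$, $\varphi(f)=\frac{1}{\sqrt2}(a^*(f)+a(f))$, $L_R=d\Gamma(u)$,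 $(J_R\Psi)(u_1,\Sigma_1,\dots,u_n,\Sigma_n)=\overline{\Psi(-u_1,\Sigma_1,\dots,-u_n,\Sigma_n)}$, and let $$g_\beta(u,\Sigma)=\sqrt{\tfrac{u}{1-e^{-\beta u}}}\;|u|^{1/2}\begin{cases} g(u,\Sigma), & u\ge0,\\ \overline{g(-u,\Sigma)}, & u<0.\end{cases}$$ On $\mathbb C^3\otimes\mathbb C^3\otimes\mathcal F$ put $L_S=H_S\otimes 1-1\otimes H_S$ and $L(\lambda)=L_S+L_R+\lambda I$, with $I=G\otimes1\otimes\varphi(g_\beta)-1\otimes G\otimes J_Re^{-\beta L_R/2}\varphi(g_\beta)J_Re^{-\beta L_R/2}$. For each eigenvalue $e\in\{0,\Delta,-\Delta\}$ of $L_S$ (of multiplicity $5,2,2$) let $P_e=\chi_{L_S=e}\otimes|\Omega\rangle\langle\Omega|$, $\overline P_e=1-P_e$, and define the level shift operator $$\Lambda_e=\lim_{\epsilon\to0+}P_e\Big(L(\lambda)-L(\lambda)\overline P_e\,(L(0)-e+i\epsilon)^{-1}\,\overline P_e L(\lambda)\Big)P_e .$$ *Approximate dynamics.* Write $\Lambda_e=\sum_s\varepsilon_e^{(s)}P_e^{(s)}$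 with rank-one projections $P_e^{(s)}$ which satisfy $P_e^{(s)}P_e^{(s')}=\delta_{ss'}P_e^{(s)}$ and $\sum_sP_e^{(s)}=\chi_{L_S=e}$. Let $\psi_{\rm ref}=3^{-1/2}\sum_j\varphi_j\otimes\varphi_j$. Given a density matrix $\rho$ on $\mathbb C^3$, let $\psi_S\in\mathbb C^3\otimes\mathbb C^3$ satisfy $\mathrm{Tr}(\rho A)=\langle\psi_S,(A\otimes1)\psi_S\rangle$ for all $A$, and let $B=1\otimes b$ be the operator with $B\psi_{\rm ref}=\psi_S$. Then $T_t(\rho)$ is defined by $$\mathrm{Tr}(T_t(\rho)A)=\sum_{e}\sum_s e^{it\varepsilon_e^{(s)}}\big\langle\psi_S,BP_e^{(s)}(A\otimes1)\psi_{\rm ref}\big\rangle\qquad\text{for all }A\in\mathcal B(\mathbb C^3).$$ **Proposition (Final state).** For every $\lambda\neq0$ the limits defining $\Lambda_0,\Lambda_{\Delta},\Lambda_{-\Delta}$ exist, and these operators are diagonalizable as above. For every density matrix $\rho_0$ on $\mathbb C^3$, $$\lim_{t\to\infty}T_t(\rho_0)=\rho_\infty=\begin{pmatrix}p_\infty&0&0\\0&\frac12(1-p_\infty)&\alpha_\infty\\0&\alpha_\infty&\frac12(1-p_\infty)\end{pmatrix},$$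 $$p_\infty=\frac{1+[\rho_0]_{11}+2\,\mathrm{Re}[\rho_0]_{23}}{2(e^{\beta\Delta}+1)},\qquad \alpha_\infty=\tfrac12\big((2e^{\beta\Delta}+1)p_\infty-1\big).$$ The matrix $\rho_\infty$ is a density matrix in the quasi-stationary manifold, that is, it is of the displayed form with $0\le p_\infty\le(e^{\beta\Delta}+1)^{-1}$, and $T_t(\rho_\infty)=\rho_\infty$ for all $t\ge0$. Moreover there are constants $C$ and $c>0$, independent of $\lambda$, $\rho_0$ and $t$, such that in trace norm $$\|T_t(\rho_0)-\rho_\infty\|_1\le Ce^{-c\lambda^2t}\qquad\text{for all }t\ge0 .$$ -/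

import Mathlib

open MeasureTheory Filter Topology
open scoped Matrix Kronecker ComplexOrder

noncomputable section

namespace ThreeLevel

/-! ### The three-level system and the reservoir -/

/-- Momentum space of a single boson. -/
abbrev Momentum : Type := EuclideanSpace ℝ (Fin 3)

/-- The unit sphere `S²`. -/
abbrev S2 : Type := Metric.sphere (0 : Momentum) 1

/-- The surface measure on `S²`. -/
def surfaceMeasure : Measure S2 := (volume : Measure Momentum).toSphere

/-- The data of the model: the inverse temperature `β`, the level `E₀`, the (mean) energy `E` of
the two (nearly) degenerate levels, and the form factor `g` of the coupling to the reservoir. -/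
structure Model where
  β : ℝ
  E₀ : ℝ
  E : ℝ
  g : Momentum → ℂ

/-- Matrices of operators on `ℂ³` in the basis `φ₁, φ₂, φ₃` (numbered `0, 1, 2`). -/
abbrev Mat3 : Type := Matrix (Fin 3) (Fin 3) ℂ

/-- Matrices of operators on `ℂ³ ⊗ ℂ³` in the basis `φ_k ⊗ φ_l`. -/
abbrev Mat9 : Type := Matrix (Fin 3 × Fin 3) (Fin 3 × Fin 3) ℂ

/-- The coupling operator `G`. -/
def G : Mat3 := !![0, 1, 1; 1, 0, 0; 1, 0, 0]

/-- Single-particle configurations `(u, Σ) ∈ ℝ × S²` of the reservoir Liouville space. -/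
abbrev Conf : Type := ℝ × S2

/-- The measure `du dΣ`. -/
def confMeasure : Measure Conf := (volume : Measure ℝ).prod surfaceMeasure

/-- Wave functions of the Fock space over `L²(ℝ × S², du dΣ)`: the `n`-particle component is a
function of `n` configurations. -/
abbrev Fock : Type := (n : ℕ) → (Fin n → Conf) → ℂ

/-- The creation operator `a*(f)`. -/
def create (f : Conf → ℂ) (ψ : Fock) : Fock
  | 0, _ => 0
  | n + 1, x => ((√((n : ℝ) + 1) : ℝ) : ℂ)⁻¹ * ∑ i : Fin (n + 1), f (x i) * ψ n (i.removeNth x)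

/-- The annihilation operator `a(f)`. -/
def annihilate (f : Conf → ℂ) (ψ : Fock) : Fock := fun n x =>
  ((√((n : ℝ) + 1) : ℝ) : ℂ) *
    ∫ y, (starRingEnd ℂ) (f y) * ψ (n + 1) (Fin.cons y x) ∂confMeasure

/-- The field operator `φ(f) = (a*(f) + a(f)) / √2`. -/
def field (f : Conf → ℂ) (ψ : Fock) : Fock := fun n x =>
  ((√2 : ℝ) : ℂ)⁻¹ * (create f ψ n x + annihilate f ψ n x)

/-- The modular conjugation `J_R`: complex conjugation and reflection `u ↦ -u`. -/
def modConj (ψ : Fock) : Fock := fun n x => (starRingEnd ℂ) (ψ n fun i => (-(x i).1, (x i).2))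

/-- The reservoir operator `exp(-β L_R / 2)`, where `L_R = dΓ(u)`. -/
def modHalf (β : ℝ) (ψ : Fock) : Fock := fun n x =>
  ((Real.exp (-β * (∑ i, (x i).1) / 2) : ℝ) : ℂ) * ψ n x

/-- Wave functions of `ℂ³ ⊗ ℂ³ ⊗ 𝓕`; `Φ k l` is the component along `φ_k ⊗ φ_l`. -/
abbrev Liouv : Type := Fin 3 → Fin 3 → Fock

/-- The vector `φ_k ⊗ φ_l ⊗ Ω`, where `Ω` is the Fock vacuum. -/
def vacuumBasis (q : Fin 3 × Fin 3) : Liouv := fun k l n _ =>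
  if n = 0 ∧ (k, l) = q then 1 else 0

namespace Model

variable (M : Model)

/-- The gap `Δ = E₀ - E`. -/
def gap : ℝ := M.E₀ - M.E

/-- The eigenvalues of the diagonal Hamiltonian `H_S(σ)`. -/
def level (σ : ℝ) : Fin 3 → ℝ := ![M.E₀, M.E + σ / 2, M.E - σ / 2]

/-- The spectral density `J(ω) = (π/2) ω² ∫_{S²} |g(ω, Σ)|² dΣ` of the reservoir. -/
def spectralDensity (ω : ℝ) : ℝ :=
  Real.pi / 2 * ω ^ 2 * ∫ s : S2, ‖M.g (ω • (s : Momentum))‖ ^ 2 ∂surfaceMeasure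

/-- The positive temperature form factor `g_β` on `ℝ × S²`. -/
def gBeta (x : Conf) : ℂ :=
  ((√(x.1 / (1 - Real.exp (-M.β * x.1))) * √|x.1| : ℝ) : ℂ) *
    if 0 ≤ x.1 then M.g (x.1 • (x.2 : Momentum))
    else (starRingEnd ℂ) (M.g ((-x.1) • (x.2 : Momentum)))

/-- The field operator `J_R exp(-β L_R/2) φ(g_β) J_R exp(-β L_R/2)`. -/
def fieldTilde (ψ : Fock) : Fock :=
  modConj (modHalf M.β (field M.gBeta (modConj (modHalf M.β ψ))))

/-- The interaction
`I = G ⊗ 1 ⊗ φ(g_β) - 1 ⊗ G ⊗ J_R exp(-β L_R/2) φ(g_β) J_R exp(-β L_R/2)`. -/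
def interaction (Φ : Liouv) : Liouv := fun k l n x =>
  (∑ m, G k m * field M.gBeta (Φ m l) n x) - ∑ m, G l m * M.fieldTilde (Φ k m) n x

/-- The Liouville operator
`L(σ, λ) = H_S(σ) ⊗ 1 - 1 ⊗ H_S(σ) + L_R + λ I`. -/
def liouville (σ lam : ℝ) (Φ : Liouv) : Liouv := fun k l n x =>
  ((M.level σ k - M.level σ l + ∑ i, (x i).1 : ℝ) : ℂ) * Φ k l n x +
    (lam : ℂ) * M.interaction Φ k l n x

/-- The eigenvalues `0, Δ, -Δ` of `L_S(0) = H_S(0) ⊗ 1 - 1 ⊗ H_S(0)`. -/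
def bohr : Fin 3 → ℝ := ![0, M.gap, -M.gap]

/-- `P_e = χ(L_S(0) = e) ⊗ |Ω⟩⟨Ω|`. -/
def projE (e : ℝ) (Φ : Liouv) : Liouv := fun k l n x =>
  if n = 0 ∧ M.level 0 k - M.level 0 l = e then Φ k l n x else 0

/-- The complementary projection `1 - P_e`. -/
def projEBar (e : ℝ) (Φ : Liouv) : Liouv := Φ - M.projE e Φ

/-- `(L(0,0) - e + i ε)⁻¹`; it commutes with `P_e`, because `L(0,0)` does. -/
def resolvent (e ε : ℝ) (Φ : Liouv) : Liouv := fun k l n x =>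
  (((M.level 0 k - M.level 0 l + ∑ i, (x i).1 - e : ℝ) : ℂ) + (ε : ℂ) * Complex.I)⁻¹ * Φ k l n x

/-- `P_e (L - L (1 - P_e) (L(0,0) - e + i ε)⁻¹ (1 - P_e) L) P_e` with `L = L(σ, λ)`. -/
def regLevelShiftOp (σ lam e ε : ℝ) (Φ : Liouv) : Liouv :=
  M.projE e
    (M.liouville σ lam (M.projE e Φ) -
      M.liouville σ lam (M.projEBar e (M.resolvent e ε (M.projEBar e
        (M.liouville σ lam (M.projE e Φ))))))

/-- The matrix of the preceding operator in the vectors `φ_k ⊗ φ_l ⊗ Ω`, at the `j`-th eigenvalue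
`e` of `L_S(0)`. All matrix elements outside the range of `P_e` vanish. -/
def regLevelShift (σ lam : ℝ) (j : Fin 3) (ε : ℝ) : Mat9 := fun q r =>
  M.regLevelShiftOp σ lam (M.bohr j) ε (vacuumBasis r) q.1 q.2 0 Fin.elim0

/-- The level shift operator `Λ_e` (`ε → 0+`), at the `j`-th eigenvalue `e` of `L_S(0)`. -/
def levelShift (σ lam : ℝ) (j : Fin 3) : Mat9 :=
  limUnder (𝓝[>] (0 : ℝ)) (M.regLevelShift σ lam j)

/-- The spectral projection of `L_S(0)` on `ℂ³ ⊗ ℂ³` at its `j`-th eigenvalue. -/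
def spectralProj (j : Fin 3) : Mat9 :=
  Matrix.diagonal fun q => if M.level 0 q.1 - M.level 0 q.2 = M.bohr j then 1 else 0

end Model

/-- The multiplicities of the eigenvalues `0, Δ, -Δ` of `L_S(0)`. -/
def mult : Fin 3 → ℕ := ![5, 2, 2]

namespace Model

variable (M : Model)

/-- Diagonal form `Λ_j = ∑ₛ ε_j⁽ˢ⁾ P_j⁽ˢ⁾` of the level shift operators: resonance energies
`ε_j⁽ˢ⁾` and rank-one (in general not orthogonal) eigenprojections `P_j⁽ˢ⁾` on the eigenspaces of
`L_S(0)`. -/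
structure Resonances (σ lam : ℝ) where
  energy : (j : Fin 3) → Fin (mult j) → ℂ
  proj : (j : Fin 3) → Fin (mult j) → Mat9
  rank_proj : ∀ j s, (proj j s).rank = 1
  proj_mul_proj : ∀ j s s', proj j s * proj j s' = if s = s' then proj j s else 0
  sum_proj : ∀ j, ∑ s, proj j s = M.spectralProj j
  levelShift_eq : ∀ j, M.levelShift σ lam j = ∑ s, energy j s • proj j s

end Model

/-! ### The approximate dynamics -/

/-- Density matrices of the three-level system. -/
def IsDensity (ρ : Mat3) : Prop := ρ.PosSemidef ∧ ρ.trace = 1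

open scoped MatrixOrder in
/-- The positive square root of a positive matrix. -/
def sqrtMat (ρ : Mat3) : Mat3 := CFC.sqrt ρ

/-- A vector `ψ_S ∈ ℂ³ ⊗ ℂ³` which represents the density matrix `ρ`. -/
def psiS (ρ : Mat3) : Fin 3 × Fin 3 → ℂ := fun q => sqrtMat ρ q.1 q.2

/-- The trace state `ψ_ref = 3^{-1/2} ∑ φ_j ⊗ φ_j`. -/
def psiRef : Fin 3 × Fin 3 → ℂ := fun q => if q.1 = q.2 then ((√3 : ℝ) : ℂ)⁻¹ else 0

/-- The operator `B = 1 ⊗ b` with `B ψ_ref = ψ_S`. -/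
def opB (ρ : Mat3) : Mat9 :=
  (1 : Mat3) ⊗ₖ (Matrix.of fun l k : Fin 3 => ((√3 : ℝ) : ℂ) * psiS ρ (k, l))

open scoped MatrixOrder in
/-- `ψ_S` represents `ρ`: `Tr(ρ A) = ⟨ψ_S, (A ⊗ 1) ψ_S⟩`. -/
theorem psiS_represents {ρ : Mat3} (h : ρ.PosSemidef) (A : Mat3) :
    (ρ * A).trace = star (psiS ρ) ⬝ᵥ ((A ⊗ₖ (1 : Mat3)) *ᵥ psiS ρ) := by
  have h0 : (0 : Mat3) ≤ ρ := h.nonneg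
  have h1 : sqrtMat ρ * sqrtMat ρ = ρ := CFC.sqrt_mul_sqrt_self ρ h0
  have h2 : (sqrtMat ρ)ᴴ = sqrtMat ρ :=
    (Matrix.nonneg_iff_posSemidef.1 (CFC.sqrt_nonneg ρ)).isHermitian
  have h3 : ∀ i j, (starRingEnd ℂ) (sqrtMat ρ i j) = sqrtMat ρ j i := fun i j => by
    conv_rhs => rw [← h2]
    rfl
  conv_lhs => rw [← h1]
  simp [Matrix.trace, Matrix.mul_apply, dotProduct, Matrix.mulVec, Fintype.sum_prod_type,
    Fin.sum_univ_three, psiS, Matrix.kroneckerMap_apply, Matrix.one_apply, h3]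
  ring

/-- `B ψ_ref = ψ_S`. -/
theorem opB_psiRef (ρ : Mat3) : opB ρ *ᵥ psiRef = psiS ρ := by
  have h : ((√3 : ℝ) : ℂ) ≠ 0 := by simp
  ext ⟨k, l⟩
  fin_cases k <;> fin_cases l <;>
  simp [opB, psiRef, Matrix.mulVec, dotProduct, Fintype.sum_prod_type,
    Matrix.kroneckerMap_apply, Matrix.one_apply] <;> field_simp

namespace Model

variable (M : Model)

/-- The partition function `Tr exp(-β H_S(σ))`. -/
def partition (σ : ℝ) : ℝ := ∑ k, Real.exp (-M.β * M.level σ k)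

/-- The operator `X_σ`, for which `ρ_{S,β,σ} = X_σ ρ_{S,β,0} X_σ`. -/
def opX (σ : ℝ) : Mat3 :=
  ((√(M.partition 0 / M.partition σ) : ℝ) : ℂ) •
    Matrix.diagonal ![1, ((Real.exp (-M.β * σ / 4) : ℝ) : ℂ), ((Real.exp (M.β * σ / 4) : ℝ) : ℂ)]

variable {M} {σ lam : ℝ}

namespace Resonances

/-- `χ̃_j⁽ˢ⁾(A) = ⟨ψ_S, B P_j⁽ˢ⁾ (A ⊗ 1) ψ_ref⟩` for the initial state `ρ`. -/
def chiTilde (D : M.Resonances σ lam) (ρ : Mat3) (j : Fin 3) (s : Fin (mult j)) (A : Mat3) : ℂ :=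
  star (psiS ρ) ⬝ᵥ (opB ρ *ᵥ (D.proj j s *ᵥ ((A ⊗ₖ (1 : Mat3)) *ᵥ psiRef)))

/-- `χ_j⁽ˢ⁾(A) = χ̃_j⁽ˢ⁾(X_σ A X_σ)`. -/
def chi (D : M.Resonances σ lam) (ρ : Mat3) (j : Fin 3) (s : Fin (mult j)) (A : Mat3) : ℂ :=
  D.chiTilde ρ j s (M.opX σ * A * M.opX σ)

/-- The expectation `∑_{j,s} exp(i t ε_j⁽ˢ⁾) χ_j⁽ˢ⁾(A)` of the observable `A` at time `t`. -/
def expectation (D : M.Resonances σ lam) (t : ℝ) (ρ A : Mat3) : ℂ :=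
  ∑ j, ∑ s, Complex.exp (Complex.I * t * D.energy j s) * D.chi ρ j s A

/-- The approximate dynamics `T_t(ρ)`, through its matrix elements
`[T_t(ρ)]_{kl} = Tr(T_t(ρ) |φ_l⟩⟨φ_k|)`. -/
def approxDynamics (D : M.Resonances σ lam) (t : ℝ) (ρ : Mat3) : Mat3 :=
  Matrix.of fun k l => D.expectation t ρ (Matrix.single l k 1)

/-- The defining property of `T_t`:
`Tr(T_t(ρ) A) = ∑_{j,s} exp(i t ε_j⁽ˢ⁾) χ_j⁽ˢ⁾(A)` for all observables `A`. -/
theorem trace_approxDynamics (D : M.Resonances σ lam) (t : ℝ) (ρ A : Mat3) :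
    (D.approxDynamics t ρ * A).trace = D.expectation t ρ A := by
  have hadd : ∀ A A', D.expectation t ρ (A + A') = D.expectation t ρ A + D.expectation t ρ A' := by
    intro A A'
    simp only [expectation, chi, chiTilde, Matrix.add_mul, Matrix.add_kronecker,
      Matrix.add_mulVec, Matrix.mulVec_add, dotProduct_add, mul_add, Finset.sum_add_distrib]
  have hsmul : ∀ (c : ℂ) A, D.expectation t ρ (c • A) = c * D.expectation t ρ A := by
    intro c A
    simp only [expectation, chi, chiTilde, Matrix.mul_smul, Matrix.smul_mul, Matrix.smul_kronecker,
      Matrix.smul_mulVec, Matrix.mulVec_smul, dotProduct_smul, Finset.mul_sum, smul_eq_mul]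
    refine Finset.sum_congr rfl fun j _ => Finset.sum_congr rfl fun s _ => ?_
    ring
  let f : Mat3 →ₗ[ℂ] ℂ :=
    { toFun := D.expectation t ρ, map_add' := hadd, map_smul' := hsmul }
  have hA : A = ∑ l, ∑ k, A l k • Matrix.single l k (1 : ℂ) := by
    conv_lhs => rw [Matrix.matrix_eq_sum_single A]
    simp [Matrix.smul_single]
  have h : f A = ∑ l, ∑ k, A l k * f (Matrix.single l k 1) := by
    conv_lhs => rw [hA]
    simp only [map_sum, map_smul, smul_eq_mul]
  change _ = f A
  rw [h, Matrix.trace, Finset.sum_comm]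
  simp only [Matrix.diag_apply, Matrix.mul_apply]
  refine Finset.sum_congr rfl fun k _ => Finset.sum_congr rfl fun l _ => ?_
  rw [mul_comm]
  rfl

end Resonances

end Model

/-! ### The final state -/

/-- The matrix with diagonal `p, (1-p)/2, (1-p)/2` and entries `α` at the places `(2,3)` and
`(3,2)`. -/
def blockMat (p α : ℝ) : Mat3 :=
  !![(p : ℂ), 0, 0;
     0, (((1 - p) / 2 : ℝ) : ℂ), (α : ℂ);
     0, (α : ℂ), (((1 - p) / 2 : ℝ) : ℂ)]

namespace Model

variable (M : Model)

/-- `α = ((2 exp(β Δ) + 1) p - 1) / 2`. -/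
def alphaOf (p : ℝ) : ℝ := ((2 * Real.exp (M.β * M.gap) + 1) * p - 1) / 2

/-- `p_∞ = (1 + [ρ₀]₁₁ + 2 Re [ρ₀]₂₃) / (2 (exp(β Δ) + 1))`. -/
def pInf (ρ₀ : Mat3) : ℝ :=
  (1 + (ρ₀ 0 0).re + 2 * (ρ₀ 1 2).re) / (2 * (Real.exp (M.β * M.gap) + 1))

/-- The final state `ρ_∞`. -/
def finalState (ρ₀ : Mat3) : Mat3 := blockMat (M.pInf ρ₀) (M.alphaOf (M.pInf ρ₀))

/-- The quasi-stationary manifold `𝓜₀`. -/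
def quasiStationary : Set Mat3 :=
  {ρ | ∃ p ∈ Set.Icc (0 : ℝ) (1 / (Real.exp (M.β * M.gap) + 1)), ρ = blockMat p (M.alphaOf p)}

end Model

/-- The trace norm: the sum of the singular values. -/
def traceNorm (A : Mat3) : ℝ :=
  ∑ i, √((Matrix.isHermitian_conjTranspose_mul_self A).eigenvalues i)

end ThreeLevel

end

open ThreeLevel

noncomputable section

namespace ThreeLevel

/-! ### Field operators on vectors with at most one particle -/

/-! The coupling `G` annihilates φ₂ - φ₃, so this state is dark, and only the bright space spanned
by φ₁ and φ₂ + φ₃ exchanges energy with the bath. To second order the dynamics is that of a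
two-level system in a thermal bath beside a decoupled level. The bright and dark populations are
conserved and everything else decays. The limit is the mixture, with weights w = `finalWeight ρ` and
1 - w, of the Gibbs state of the bright two-level system and the dark state.

The interaction changes the particle number by one, so its second-order term on the vacuum is a
one-particle integral. By the KMS symmetry `gBeta_neg` both fields create the same one-particle
function, and `regLevelShift_apply` expresses the level shift operators through `resonanceIntegral`,
where `G` lets only the energies ±Δ contribute. The Sokhotski-Plemelj formula
(`exists_tendsto_integral_inv`) gives boundary values X at -Δ and Y at Δ, with imaginary parts -(1 -
η)T and -ηT, where η = `weight` and T = `width`. This is detailed balance, and it is what makes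
explicit biorthogonal modes diagonalize the operators (`sum_modeShift_modes`). Two of the nine modes
are stationary; the shifts of the other seven have imaginary part at least λ²ηT (`le_im_modeShift`).

The dynamics depends on a diagonal form only through exp(itΛ_e) (`sum_smul_proj_eq`), so an
arbitrary `Resonances` may be replaced by the explicit one. There the final state is the
contribution of the two stationary modes (`finalState_apply`), and the rest is seven decaying terms,
bounded uniformly in the initial state. -/

theorem field_apply_zero (f : Conf → ℂ) (ψ : Fock) (x : Fin 0 → Conf) :
    field f ψ 0 x = ((√2 : ℝ) : ℂ)⁻¹ *
      ∫ y, (starRingEnd ℂ) (f y) * ψ 1 (Fin.cons y x) ∂confMeasure := by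
  simp [field, create, annihilate]

theorem field_apply_one (f : Conf → ℂ) (ψ : Fock) (h : ψ 2 = 0) (x : Fin 1 → Conf) :
    field f ψ 1 x = ((√2 : ℝ) : ℂ)⁻¹ * (f (x 0) * ψ 0 Fin.elim0) := by
  have h0 : (Fin.removeNth (0 : Fin 1) x) = Fin.elim0 := Subsingleton.elim _ _
  simp [field, create, annihilate, h, h0]

theorem vacuumBasis_zero (r : Fin 3 × Fin 3) (k l : Fin 3) (x : Fin 0 → Conf) :
    vacuumBasis r k l 0 x = if (k, l) = r then 1 else 0 := by
  simp [vacuumBasis]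

theorem vacuumBasis_succ (r : Fin 3 × Fin 3) (k l : Fin 3) (n : ℕ) :
    vacuumBasis r k l (n + 1) = 0 := by
  ext x
  simp [vacuumBasis]

/-- The matrix of the coupling `G ⊗ 1 - 1 ⊗ G`. -/
def couplingMat (r : Fin 3 × Fin 3) (k l : Fin 3) : ℂ :=
  (if l = r.2 then G k r.1 else 0) - if k = r.1 then G l r.2 else 0

namespace Model

variable (M : Model)

/-- Detailed balance of the Planck factor u / (1 - exp(-βu)): reflecting u costs exp(-βu), and the
square root halves the exponent. -/
theorem sqrt_thermal_neg (u : ℝ) :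
    √(-u / (1 - Real.exp (-M.β * -u))) =
      Real.exp (-M.β * u / 2) * √(u / (1 - Real.exp (-M.β * u))) := by
  have h1 : (1 - Real.exp (-M.β * -u)) =
      -(Real.exp (M.β * u) * (1 - Real.exp (-M.β * u))) := by
    rw [mul_sub, ← Real.exp_add]
    simp
  rw [h1, neg_div_neg_eq, Real.exp_half, ← Real.sqrt_mul (Real.exp_pos _).le, ← div_div,
    mul_div_assoc', div_eq_mul_inv u, ← Real.exp_neg, mul_comm u, neg_mul]

/-- The KMS symmetry of the thermal form factor. -/
theorem gBeta_neg (u : ℝ) (s : S2) :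
    M.gBeta (-u, s) = ((Real.exp (-M.β * u / 2) : ℝ) : ℂ) * (starRingEnd ℂ) (M.gBeta (u, s)) := by
  simp only [gBeta, sqrt_thermal_neg, abs_neg, map_mul, Complex.conj_ofReal]
  rcases lt_trichotomy u 0 with h | rfl | h
  · have h1 : 0 ≤ -u := by linarith
    simp only [h1, h.not_ge, if_true, if_false, Complex.conj_conj]
    push_cast
    ring
  · simp
  · have h1 : ¬ 0 ≤ -u := by linarith
    simp only [h1, h.le, if_true, if_false, neg_neg]
    push_cast
    ring

theorem fieldTilde_apply_zero (ψ : Fock) (x : Fin 0 → Conf) :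
    M.fieldTilde ψ 0 x = ((√2 : ℝ) : ℂ)⁻¹ *
      ∫ y, M.gBeta y * (((Real.exp (M.β * y.1 / 2) : ℝ) : ℂ) *
        ψ 1 (fun _ => (-y.1, y.2))) ∂confMeasure := by
  simp only [fieldTilde, modConj, modHalf, field_apply_zero]
  simp only [Finset.univ_eq_empty, Finset.sum_empty, mul_zero, zero_div, Real.exp_zero,
    Complex.ofReal_one, one_mul, map_mul, map_inv₀, Complex.conj_ofReal]
  rw [← integral_conj]
  congr 1
  refine integral_congr_ae (Eventually.of_forall fun y => ?_)
  have h : (fun i => (-((Fin.cons y fun i => (-(x i).1, (x i).2) : Fin 1 → Conf) i).1,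
      ((Fin.cons y fun i => (-(x i).1, (x i).2) : Fin 1 → Conf) i).2)) =
      fun _ : Fin 1 => (-y.1, y.2) := by
    funext i
    rw [show i = 0 from Fin.fin_one_eq_zero i, Fin.cons_zero]
  simp only [h, map_mul, Complex.conj_conj, Complex.conj_ofReal, Fin.sum_univ_one, Fin.cons_zero,
    neg_mul_neg]

/-- The factor exp(βu/2) left by the modular operators cancels the KMS factor in `gBeta_neg`, so the
conjugated field creates the same one-particle function as `field M.gBeta`. The two parts of the
interaction then combine into `couplingMat`. -/
theorem fieldTilde_apply_one (ψ : Fock) (h : ψ 2 = 0) (x : Fin 1 → Conf) :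
    M.fieldTilde ψ 1 x = ((√2 : ℝ) : ℂ)⁻¹ * (M.gBeta (x 0) * ψ 0 Fin.elim0) := by
  have h2 : modConj (modHalf M.β ψ) 2 = 0 := by
    ext y
    simp [modConj, modHalf, h]
  have h0 : (fun i => (-(Fin.elim0 i : Conf).1, (Fin.elim0 i : Conf).2)) =
    (Fin.elim0 : Fin 0 → Conf) := Subsingleton.elim _ _
  simp only [fieldTilde]
  rw [modConj, modHalf, field_apply_one _ _ h2, gBeta_neg]
  have h3 : Real.exp (M.β * (x 0).1 / 2) * Real.exp (-M.β * (x 0).1 / 2) = 1 := by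
    rw [← Real.exp_add, ← Real.exp_zero]
    congr 1
    ring
  have h4 : ((Real.exp (M.β * (x 0).1 / 2) : ℝ) : ℂ) *
      ((Real.exp (-M.β * (x 0).1 / 2) : ℝ) : ℂ) = 1 := by
    rw [← Complex.ofReal_mul, h3, Complex.ofReal_one]
  simp only [modConj, modHalf, h0, map_mul, map_inv₀, Complex.conj_ofReal, Complex.conj_conj,
    Fin.sum_univ_one, Finset.univ_eq_empty, Finset.sum_empty, mul_zero, zero_div, Real.exp_zero,
    Complex.ofReal_one, one_mul, neg_mul_neg]
  linear_combination (((√2 : ℝ) : ℂ)⁻¹ * (M.gBeta (x 0) * ψ 0 Fin.elim0)) * h4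

theorem liouville_vacuumBasis_zero (lam : ℝ) (r : Fin 3 × Fin 3) (k l : Fin 3)
    (x : Fin 0 → Conf) :
    M.liouville 0 lam (vacuumBasis r) k l 0 x =
      ((M.level 0 k - M.level 0 l : ℝ) : ℂ) * if (k, l) = r then 1 else 0 := by
  simp [liouville, interaction, field_apply_zero, fieldTilde_apply_zero, vacuumBasis_succ _ _ _ 0,
    vacuumBasis_zero]

theorem liouville_vacuumBasis_one (lam : ℝ) (r : Fin 3 × Fin 3) (k l : Fin 3)
    (x : Fin 1 → Conf) :
    M.liouville 0 lam (vacuumBasis r) k l 1 x =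
      lam * (((√2 : ℝ) : ℂ)⁻¹ * M.gBeta (x 0) * couplingMat r k l) := by
  simp only [liouville, interaction, field_apply_one _ _ (vacuumBasis_succ _ _ _ 1),
    fieldTilde_apply_one _ _ (vacuumBasis_succ _ _ _ 1), vacuumBasis_succ _ _ _ 0,
    vacuumBasis_zero, couplingMat, Prod.ext_iff]
  have h1 : ∀ m, (if m = r.1 ∧ l = r.2 then (1 : ℂ) else 0) =
      if m = r.1 then if l = r.2 then 1 else 0 else 0 := fun m => ite_and ..
  have h2 : ∀ m, (if k = r.1 ∧ m = r.2 then (1 : ℂ) else 0) =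
      if m = r.2 then if k = r.1 then 1 else 0 else 0 := fun m => by
    split_ifs <;> simp_all
  simp only [h1, h2, mul_ite, mul_one, mul_zero, Finset.sum_ite_eq', Finset.mem_univ, if_true,
    Pi.zero_apply, zero_add]
  split_ifs <;> ring

/-- Serves the columns outside the range of P_e, where P_e already sends the basis vector to zero.
-/
theorem liouville_zero (σ lam : ℝ) : M.liouville σ lam 0 = 0 := by
  ext k l n x
  have h1 : ∀ f, field f (0 : Fock) = 0 := by
    intro f
    ext n x
    cases n <;> simp [field, create, annihilate]
  have h2 : ∀ m, (0 : Liouv) k m = 0 := fun m => rfl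
  have h3 : modConj (modHalf M.β 0) = 0 := by
    ext n x
    simp [modConj, modHalf]
  simp [liouville, interaction, fieldTilde, h1, h3]

theorem projE_zero (e : ℝ) : M.projE e 0 = 0 := by
  ext k l n x
  simp [projE]

theorem resolvent_zero (e ε : ℝ) : M.resolvent e ε 0 = 0 := by
  ext k l n x
  simp [resolvent]

theorem projE_vacuumBasis (e : ℝ) (r : Fin 3 × Fin 3) :
    M.projE e (vacuumBasis r) =
      if M.level 0 r.1 - M.level 0 r.2 = e then vacuumBasis r else 0 := by
  ext k l n x
  by_cases h : (k, l) = r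
  · subst h
    by_cases hn : n = 0 <;> by_cases he : M.level 0 k - M.level 0 l = e <;>
      simp [projE, vacuumBasis, hn, he]
  · split_ifs <;> simp [projE, vacuumBasis, h]

/-- The resonance integral `⟨g_β, (u + a + iε)⁻¹ g_β⟩`. -/
def resonanceIntegral (a ε : ℝ) : ℂ :=
  ∫ y, ((‖M.gBeta y‖ ^ 2 : ℝ) : ℂ) * (((y.1 + a : ℝ) : ℂ) + ε * Complex.I)⁻¹ ∂confMeasure

/-- The one-particle vector to which the second application of the interaction is made. -/
theorem projEBar_resolvent_apply (lam e ε : ℝ) (r : Fin 3 × Fin 3)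
    (hr : M.level 0 r.1 - M.level 0 r.2 = e) (k l : Fin 3) :
    (M.projEBar e (M.resolvent e ε (M.projEBar e (M.liouville 0 lam (vacuumBasis r))))) k l 0 = 0 ∧
    ∀ x, (M.projEBar e (M.resolvent e ε (M.projEBar e (M.liouville 0 lam (vacuumBasis r))))) k l 1 x
      = (((M.level 0 k - M.level 0 l + (x 0).1 - e : ℝ) : ℂ) + (ε : ℂ) * Complex.I)⁻¹ *
        (lam * (((√2 : ℝ) : ℂ)⁻¹ * M.gBeta (x 0) * couplingMat r k l)) := by
  constructor
  · ext x
    simp only [projEBar, resolvent, Pi.sub_apply, projE, liouville_vacuumBasis_zero]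
    -- The vacuum component of the image is a multiple of the basis vector itself, which lies in the
    -- range of P_e and is removed by 1 - P_e.
    by_cases h : (k, l) = r
    · subst h
      simp [hr]
    · simp [h]
  · intro x
    simp only [projEBar, resolvent, Pi.sub_apply, projE, liouville_vacuumBasis_one]
    simp

/-- The conjugate of (-u + a + iε)⁻¹ is -(u - a + iε)⁻¹. Hence the terms from the conjugated field
need no boundary values of their own. -/
theorem resonanceIntegral_reflect (a ε : ℝ) :
    ∫ y, ((‖M.gBeta y‖ ^ 2 : ℝ) : ℂ) * (((-y.1 + a : ℝ) : ℂ) + ε * Complex.I)⁻¹ ∂confMeasure =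
      -(starRingEnd ℂ) (M.resonanceIntegral (-a) ε) := by
  rw [resonanceIntegral, ← integral_conj, ← integral_neg]
  refine integral_congr_ae (Eventually.of_forall fun y => ?_)
  simp only [map_mul, Complex.conj_ofReal, map_inv₀, map_add, Complex.conj_I]
  rw [← mul_neg, ← inv_neg]
  congr 2
  push_cast
  ring

/-- The intermediate vector has one boson of energy u and one changed index. Subtracting e from its
energy cancels the index left unchanged, so only the transition energy of the index acted on enters
the resolvent. -/
theorem regLevelShift_apply (lam ε : ℝ) (j : Fin 3) (q r : Fin 3 × Fin 3) :
    M.regLevelShift 0 lam j ε q r =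
      if M.level 0 q.1 - M.level 0 q.2 = M.bohr j ∧ M.level 0 r.1 - M.level 0 r.2 = M.bohr j then
        (M.bohr j : ℂ) * (if q = r then 1 else 0) - lam ^ 2 / 2 *
          ∑ m, (G q.1 m * (M.resonanceIntegral (M.level 0 m - M.level 0 q.1) ε *
              couplingMat r m q.2) +
            G q.2 m * ((starRingEnd ℂ) (M.resonanceIntegral (M.level 0 m - M.level 0 q.2) ε) *
              couplingMat r q.1 m))
      else 0 := by
  rw [regLevelShift, regLevelShiftOp, projE_vacuumBasis]
  by_cases hr : M.level 0 r.1 - M.level 0 r.2 = M.bohr j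
  swap
  · simp [hr, liouville_zero, projEBar, projE_zero, resolvent_zero]
  rw [if_pos hr]
  by_cases hq : M.level 0 q.1 - M.level 0 q.2 = M.bohr j
  swap
  · simp [hq, projE]
  simp only [projE, hq, hr, and_self, if_true]
  rw [Pi.sub_apply, Pi.sub_apply, Pi.sub_apply, Pi.sub_apply, liouville_vacuumBasis_zero, hq]
  congr 1
  set Ψ := M.projEBar (M.bohr j) (M.resolvent (M.bohr j) ε
    (M.projEBar (M.bohr j) (M.liouville 0 lam (vacuumBasis r)))) with hΨ
  have h0 : ∀ k l, Ψ k l 0 = 0 := fun k l =>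
    (M.projEBar_resolvent_apply lam (M.bohr j) ε r hr k l).1
  have h1 : ∀ k l x, Ψ k l 1 x = _ := fun k l =>
    (M.projEBar_resolvent_apply lam (M.bohr j) ε r hr k l).2
  have hs : (((√2 : ℝ) : ℂ)⁻¹) * (((√2 : ℝ) : ℂ)⁻¹) = 1 / 2 := by
    rw [← mul_inv, ← Complex.ofReal_mul, Real.mul_self_sqrt (by norm_num)]
    norm_num
  have hA : ∀ m, field M.gBeta (Ψ m q.2) 0 Fin.elim0 = lam / 2 *
      (M.resonanceIntegral (M.level 0 m - M.level 0 q.1) ε * couplingMat r m q.2) := by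
    intro m
    rw [field_apply_zero]
    have : ∀ y : Conf, (starRingEnd ℂ) (M.gBeta y) * Ψ m q.2 1 (Fin.cons y Fin.elim0) =
        (((‖M.gBeta y‖ ^ 2 : ℝ) : ℂ) * (((y.1 + (M.level 0 m - M.level 0 q.1) : ℝ) : ℂ) +
          ε * Complex.I)⁻¹) * (lam * ((√2 : ℝ) : ℂ)⁻¹ * couplingMat r m q.2) := by
      intro y
      rw [h1, ← Complex.normSq_eq_norm_sq, ← Complex.mul_conj, ← hq]
      have : M.level 0 m - M.level 0 q.2 + ((Fin.cons y Fin.elim0 : Fin 1 → Conf) 0).1 -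
        (M.level 0 q.1 - M.level 0 q.2) = y.1 + (M.level 0 m - M.level 0 q.1) := by
        simp only [Fin.cons_zero]
        ring
      simp only [Fin.cons_zero] at this ⊢
      rw [this]
      ring
    simp only [this]
    rw [integral_mul_const]
    change _ * (M.resonanceIntegral _ ε * _) = _
    linear_combination (M.resonanceIntegral (M.level 0 m - M.level 0 q.1) ε * (lam *
      couplingMat r m q.2)) * hs
  -- Here exp(βu/2) cancels the KMS factor again, and the reflection yields minus a conjugate. This
  -- sign compensates the minus in front of the conjugated field in the interaction.
  have hB : ∀ m, M.fieldTilde (Ψ q.1 m) 0 Fin.elim0 = -(lam / 2 *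
      ((starRingEnd ℂ) (M.resonanceIntegral (M.level 0 m - M.level 0 q.2) ε) *
        couplingMat r q.1 m)) := by
    intro m
    rw [fieldTilde_apply_zero]
    have : ∀ y : Conf, M.gBeta y * (((Real.exp (M.β * y.1 / 2) : ℝ) : ℂ) *
        Ψ q.1 m 1 (fun _ => (-y.1, y.2))) =
        (((‖M.gBeta y‖ ^ 2 : ℝ) : ℂ) * (((-y.1 + (M.level 0 q.2 - M.level 0 m) : ℝ) : ℂ) +
          ε * Complex.I)⁻¹) * (lam * ((√2 : ℝ) : ℂ)⁻¹ * couplingMat r q.1 m) := by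
      intro y
      have h3 : Real.exp (M.β * y.1 / 2) * Real.exp (-M.β * y.1 / 2) = 1 := by
        rw [← Real.exp_add, ← Real.exp_zero]
        congr 1
        ring
      have h4 : ((Real.exp (M.β * y.1 / 2) : ℝ) : ℂ) *
          ((Real.exp (-M.β * y.1 / 2) : ℝ) : ℂ) = 1 := by
        rw [← Complex.ofReal_mul, h3, Complex.ofReal_one]
      rw [h1, ← Complex.normSq_eq_norm_sq, ← Complex.mul_conj, ← hq, gBeta_neg]
      have : M.level 0 q.1 - M.level 0 m + -y.1 - (M.level 0 q.1 - M.level 0 q.2) =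
        -y.1 + (M.level 0 q.2 - M.level 0 m) := by ring
      rw [this]
      linear_combination (M.gBeta y * (((-y.1 + (M.level 0 q.2 - M.level 0 m) : ℝ) : ℂ) +
          ε * Complex.I)⁻¹ * (starRingEnd ℂ) (M.gBeta y) *
          (lam * ((√2 : ℝ) : ℂ)⁻¹ * couplingMat r q.1 m)) * h4
    simp only [this]
    rw [integral_mul_const, resonanceIntegral_reflect, neg_sub]
    linear_combination (-(starRingEnd ℂ) (M.resonanceIntegral (M.level 0 m - M.level 0 q.2) ε) *
      (lam * couplingMat r q.1 m)) * hs
  simp only [liouville, interaction, h0, hA, hB, Pi.zero_apply, mul_zero, zero_add]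
  rw [← Finset.sum_sub_distrib, Finset.mul_sum, Finset.mul_sum]
  refine Finset.sum_congr rfl fun m _ => ?_
  ring

end Model

end ThreeLevel

end
noncomputable section

namespace ThreeLevel

/-! ### The Sokhotski-Plemelj formula -/

/-- The singular part of the Sokhotski-Plemelj formula. -/
theorem tendsto_integral_Icc_inv {a δ : ℝ} (hδ : 0 < δ) :
    Tendsto (fun ε : ℝ => ∫ u in Set.Icc (a - δ) (a + δ),
      (((u - a : ℝ) : ℂ) + ε * Complex.I)⁻¹) (𝓝[>] 0) (𝓝 (-(Real.pi * Complex.I))) := by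
  have h1 : ∀ ε : ℝ, 0 < ε → ∫ u in Set.Icc (a - δ) (a + δ),
      (((u - a : ℝ) : ℂ) + ε * Complex.I)⁻¹ =
      Complex.log (δ + ε * Complex.I) - Complex.log (((-δ : ℝ) : ℂ) + ε * Complex.I) := by
    intro ε hε
    have hs : ∀ v : ℝ, ((v : ℂ) + ε * Complex.I) ∈ Complex.slitPlane := fun v => by
      rw [Complex.mem_slitPlane_iff]
      right
      simpa using hε.ne'
    have hd : ∀ v : ℝ, HasDerivAt (fun v : ℝ => Complex.log ((v : ℂ) + ε * Complex.I))
        (((v : ℂ) + ε * Complex.I)⁻¹) v := fun v => by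
      have h2 : HasDerivAt (fun v : ℝ => (v : ℂ) + ε * Complex.I) 1 v :=
        (Complex.ofRealCLM.hasDerivAt (x := v)).add_const _
      simpa using h2.clog_real (hs v)
    rw [integral_Icc_eq_integral_Ioc, ← intervalIntegral.integral_of_le (by linarith),
      intervalIntegral.integral_comp_sub_right
        (fun v : ℝ => (((v : ℝ) : ℂ) + ε * Complex.I)⁻¹) a]
    rw [intervalIntegral.integral_eq_sub_of_hasDerivAt (fun v _ => hd v)]
    · simp
    · refine Continuous.intervalIntegrable ?_ _ _
      refine Continuous.inv₀ (by fun_prop) fun v => Complex.slitPlane_ne_zero (hs v)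
  have hc : ∀ v : ℝ, Tendsto (fun ε : ℝ => (v : ℂ) + ε * Complex.I) (𝓝[>] 0) (𝓝 (v : ℂ)) := by
    intro v
    have : Continuous fun ε : ℝ => (v : ℂ) + ε * Complex.I := by fun_prop
    simpa using (this.tendsto 0).mono_left nhdsWithin_le_nhds
  have h2 : Tendsto (fun ε : ℝ => Complex.log (δ + ε * Complex.I)) (𝓝[>] 0)
      (𝓝 (Complex.log δ)) :=
    (continuousAt_clog (x := (δ : ℂ)) (Complex.ofReal_mem_slitPlane.2 hδ)).tendsto.comp (hc δ)
  -- The endpoint -δ lies on the branch cut and is approached from the upper half plane; this is the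
  -- source of the term iπ.
  have h3 : Tendsto (fun ε : ℝ => Complex.log (((-δ : ℝ) : ℂ) + ε * Complex.I)) (𝓝[>] 0)
      (𝓝 (Real.log δ + Real.pi * Complex.I)) := by
    have := Complex.tendsto_log_nhdsWithin_im_nonneg_of_re_neg_of_im_zero
      (z := ((-δ : ℝ) : ℂ)) (by simpa using hδ) (by simp)
    rw [Complex.norm_real, norm_neg, Real.norm_of_nonneg hδ.le] at this
    refine this.comp (tendsto_nhdsWithin_iff.2 ⟨hc _, ?_⟩)
    filter_upwards [self_mem_nhdsWithin] with ε hε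
    simpa using (Set.mem_Ioi.1 hε).le
  have h4 := h2.sub h3
  rw [← Complex.ofReal_log hδ.le, sub_add_cancel_left] at h4
  refine h4.congr' ?_
  filter_upwards [self_mem_nhdsWithin] with ε hε using (h1 ε hε).symm

/-- `1 / (u - a + i0)` has imaginary part `-π δ_a`. -/
theorem exists_tendsto_integral_inv {h : ℝ → ℝ} (hi : Integrable h) {a : ℝ}
    (hd : DifferentiableAt ℝ h a) :
    ∃ A : ℝ, Tendsto (fun ε : ℝ => ∫ u, (h u : ℂ) * (((u - a : ℝ) : ℂ) + ε * Complex.I)⁻¹)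
      (𝓝[>] 0) (𝓝 (A - (Real.pi * h a : ℝ) * Complex.I)) := by
  obtain ⟨C, hC, hO⟩ := hd.isBigO_sub.exists_pos
  obtain ⟨δ, hδ, hball⟩ := Metric.eventually_nhds_iff.1 hO.bound
  -- Subtracting h(a) on a symmetric interval leaves `k`, which is O(u - a) near a, so that k(u)/(u
  -- - a) is dominated. Half the radius keeps the closed interval inside the open ball of the
  -- estimate.
  set S : Set ℝ := Set.Icc (a - δ / 2) (a + δ / 2) with hS
  have hSm : MeasurableSet S := measurableSet_Icc
  have hSfin : volume S ≠ ⊤ := by simp [hS]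
  set k : ℝ → ℝ := fun u => h u - S.indicator (fun _ => h a) u with hk
  have hconst : Integrable (S.indicator fun _ => h a) :=
    (integrable_indicator_iff hSm).2 (integrableOn_const hSfin)
  have hki : Integrable k := hi.sub hconst
  have hnorm : ∀ u ε : ℝ, 0 < |u - a| →
      ‖(((u - a : ℝ) : ℂ) + ε * Complex.I)⁻¹‖ ≤ |u - a|⁻¹ := by
    intro u ε hu
    rw [norm_inv]
    refine inv_anti₀ hu ?_
    simpa using Complex.abs_re_le_norm (((u - a : ℝ) : ℂ) + ε * Complex.I)
  have hka : k a = 0 := by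
    have : a ∈ S := ⟨by linarith, by linarith⟩
    simp [hk, this]
  have hlim : Tendsto (fun ε : ℝ => ∫ u, (k u : ℂ) * (((u - a : ℝ) : ℂ) + ε * Complex.I)⁻¹)
      (𝓝[>] 0) (𝓝 (∫ u, ((k u / (u - a) : ℝ) : ℂ))) := by
    refine tendsto_integral_filter_of_dominated_convergence
      (fun u => S.indicator (fun _ => C) u + |h u| * (δ / 2)⁻¹) ?_ ?_ ?_ ?_
    · refine Eventually.of_forall fun ε => ?_
      refine AEStronglyMeasurable.mul ?_ ?_
      · exact Complex.continuous_ofReal.comp_aestronglyMeasurable hki.1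
      · exact (by fun_prop : Measurable fun u : ℝ =>
          (((u - a : ℝ) : ℂ) + ε * Complex.I)⁻¹).aestronglyMeasurable
    · refine Eventually.of_forall fun ε => Eventually.of_forall fun u => ?_
      rw [norm_mul, Complex.norm_real, Real.norm_eq_abs]
      by_cases hu : u ∈ S
      · have h0 : 0 ≤ |h u| * (δ / 2)⁻¹ := by positivity
        rw [Set.indicator_of_mem hu]
        rcases eq_or_ne u a with rfl | hua
        · rw [hka, abs_zero, zero_mul]
          positivity
        · have h1 : |k u| ≤ C * |u - a| := by
            have := hball (y := u) (by
              rw [Real.dist_eq, abs_lt]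
              constructor <;> linarith [hu.1, hu.2])
            simpa [hk, hu] using this
          have hpos : 0 < |u - a| := abs_pos.2 (sub_ne_zero.2 hua)
          calc |k u| * _ ≤ (C * |u - a|) * |u - a|⁻¹ :=
                mul_le_mul h1 (hnorm u ε hpos) (norm_nonneg _) ((abs_nonneg _).trans h1)
            _ = C := by field_simp
            _ ≤ _ := by linarith
      · have h1 : δ / 2 ≤ |u - a| := by
          by_contra hlt
          rw [not_le, abs_lt] at hlt
          exact hu ⟨by linarith, by linarith⟩
        rw [Set.indicator_of_notMem hu, zero_add]
        have h2 : k u = h u := by simp [hk, hu]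
        rw [h2]
        gcongr
        exact (hnorm u ε (by linarith)).trans (inv_anti₀ (by linarith) h1)
    · exact ((integrable_indicator_iff hSm).2 (integrableOn_const hSfin)).add
        (hi.abs.mul_const _)
    · refine Eventually.of_forall fun u => ?_
      rcases eq_or_ne u a with rfl | hua
      · simp [hka]
      · have hne : ((u - a : ℝ) : ℂ) ≠ 0 := by
          exact_mod_cast sub_ne_zero.2 hua
        have hc : Continuous fun ε : ℝ => ((u - a : ℝ) : ℂ) + ε * Complex.I := by fun_prop
        have h1 : Tendsto (fun ε : ℝ => ((u - a : ℝ) : ℂ) + ε * Complex.I) (𝓝[>] 0)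
            (𝓝 ((u - a : ℝ) : ℂ)) := by
          simpa using (hc.tendsto 0).mono_left nhdsWithin_le_nhds
        have h2 := (h1.inv₀ hne).const_mul (k u : ℂ)
        rw [Complex.ofReal_div, div_eq_mul_inv]
        exact h2
  -- By symmetry the constant piece contributes only -iπh(a), so the real part comes from `k` alone.
  refine ⟨∫ u, k u / (u - a), ?_⟩
  have hsum := hlim.add ((tendsto_integral_Icc_inv (a := a) (half_pos hδ)).const_mul (h a : ℂ))
  rw [integral_complex_ofReal] at hsum
  have hval : ((∫ u, k u / (u - a) : ℝ) : ℂ) + h a * -(Real.pi * Complex.I) =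
      ((∫ u, k u / (u - a) : ℝ) : ℂ) - (Real.pi * h a : ℝ) * Complex.I := by
    push_cast
    ring
  rw [hval] at hsum
  refine hsum.congr' ?_
  filter_upwards [self_mem_nhdsWithin] with ε hε
  have hε' : 0 < ε := hε
  have hb : ∀ u : ℝ, ‖(((u - a : ℝ) : ℂ) + ε * Complex.I)⁻¹‖ ≤ ε⁻¹ := by
    intro u
    rw [norm_inv]
    refine inv_anti₀ hε' ?_
    have := Complex.abs_im_le_norm (((u - a : ℝ) : ℂ) + ε * Complex.I)
    simpa [abs_of_pos hε'] using this
  have hm : AEStronglyMeasurable (fun u : ℝ => (((u - a : ℝ) : ℂ) + ε * Complex.I)⁻¹) volume :=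
    (by fun_prop : Measurable fun u : ℝ =>
      (((u - a : ℝ) : ℂ) + ε * Complex.I)⁻¹).aestronglyMeasurable
  rw [← integral_const_mul, ← integral_indicator hSm, ← integral_add]
  · refine integral_congr_ae (Eventually.of_forall fun u => ?_)
    by_cases hu : u ∈ S
    · simp only [hk, Set.indicator_of_mem hu]
      push_cast
      ring
    · simp only [hk, Set.indicator_of_notMem hu]
      simp
  · exact hki.ofReal.mul_bdd hm (Eventually.of_forall hb)
  · rw [integrable_indicator_iff hSm]
    refine Integrable.const_mul ?_ _
    refine Measure.integrableOn_of_bounded hSfin hm (M := ε⁻¹) (Eventually.of_forall hb)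

end ThreeLevel

end
noncomputable section

namespace ThreeLevel

/-! ### The thermal density of the reservoir -/

instance : SFinite surfaceMeasure := by
  unfold surfaceMeasure
  infer_instance

/-- Polar coordinates in dimension 3. The radial measure lives on the subtype of positive reals with
density r², and is carried to the half-line by the inclusion. -/
theorem integrable_polar {f : Momentum → ℝ} (hf : Integrable f) :
    Integrable (fun y : Conf => y.1 ^ 2 * f (y.1 • (y.2 : Momentum)))
      (((volume : Measure ℝ).restrict (Set.Ioi 0)).prod surfaceMeasure) := by
  have h1 : Integrable (f ∘ ((↑) : ({0}ᶜ : Set Momentum) → Momentum))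
      ((volume : Measure Momentum).comap (↑)) :=
    (integrableOn_iff_comap_subtypeVal (by measurability)).1 hf.integrableOn
  have : SigmaFinite ((volume : Measure ℝ).comap ((↑) : Set.Ioi (0 : ℝ) → ℝ)) := by
    refine SigmaFinite.of_map _ measurable_subtype_coe.aemeasurable ?_
    rw [map_comap_subtype_coe measurableSet_Ioi]
    infer_instance
  have hmp := (volume : Measure Momentum).measurePreserving_homeomorphUnitSphereProd
  have hmp' : MeasurePreserving (homeomorphUnitSphereProd Momentum).symm _ _ :=
    MeasurePreserving.symm (homeomorphUnitSphereProd Momentum).toMeasurableEquiv hmp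
  have h2 := (hmp'.integrable_comp_emb (Homeomorph.measurableEmbedding _)).2 h1
  rw [finrank_euclideanSpace_fin, Measure.volumeIoiPow,
    prod_withDensity_right (by fun_prop),
    integrable_withDensity_iff_integrable_smul' (by fun_prop) (by simp)] at h2
  have h3 := h2.swap
  rw [← map_comap_subtype_coe measurableSet_Ioi, ← Measure.map_id (μ := surfaceMeasure),
    Measure.map_prod_map _ _ measurable_subtype_coe measurable_id]
  have hemb : MeasurableEmbedding (Prod.map ((↑) : Set.Ioi (0 : ℝ) → ℝ) (id : S2 → S2)) :=
    (MeasurableEmbedding.subtype_coe measurableSet_Ioi).prodMap MeasurableEmbedding.id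
  rw [hemb.integrable_map_iff]
  refine h3.congr (Eventually.of_forall fun y => ?_)
  have hy : 0 < (y.1 : ℝ) := y.1.2
  simp only [Function.comp_apply, Prod.swap, Prod.map, homeomorphUnitSphereProd_symm_apply_coe,
    smul_eq_mul, id]
  rw [ENNReal.toReal_ofReal (by positivity)]

namespace Model

variable (M : Model)

theorem norm_gBeta_sq (hβ : 0 < M.β) {u : ℝ} (hu : 0 < u) (s : S2) :
    ‖M.gBeta (u, s)‖ ^ 2 =
      u ^ 2 / (1 - Real.exp (-M.β * u)) * ‖M.g (u • (s : Momentum))‖ ^ 2 := by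
  have h1 : 0 < 1 - Real.exp (-M.β * u) := by
    rw [sub_pos, Real.exp_lt_one_iff]
    nlinarith
  simp only [gBeta, hu.le, if_true, norm_mul, Complex.norm_real, mul_pow, Real.norm_eq_abs, sq_abs]
  rw [Real.sq_sqrt (by positivity), Real.sq_sqrt (by positivity), abs_of_pos hu]
  ring

theorem norm_gBeta_neg_sq (u : ℝ) (s : S2) :
    ‖M.gBeta (-u, s)‖ ^ 2 = Real.exp (-M.β * u) * ‖M.gBeta (u, s)‖ ^ 2 := by
  rw [gBeta_neg, norm_mul, mul_pow, Complex.norm_real, Real.norm_of_nonneg (Real.exp_pos _).le,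
    ← Real.exp_nat_mul, RCLike.norm_conj]
  congr 2
  push_cast
  ring

/-- The thermal factor behaves like 1/(βu) near u = 0, where the infrared condition is needed, and
is bounded at large u, where square integrability of g suffices. Negative frequencies follow from
the KMS factor exp(-βu) ≤ 1. -/
theorem integrable_norm_gBeta_sq (hβ : 0 < M.β) (hg : MemLp M.g 2 (volume : Measure Momentum))
    (hIR : Integrable (fun k : Momentum => ‖M.g k‖ ^ 2 / ‖k‖) volume) :
    Integrable (fun y => ‖M.gBeta y‖ ^ 2) confMeasure := by
  have hae : ∀ᵐ y ∂((volume : Measure ℝ).restrict (Set.Ioi 0)).prod surfaceMeasure, 0 < y.1 :=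
    Measure.quasiMeasurePreserving_fst.ae (ae_restrict_mem measurableSet_Ioi)
  have hpos : Integrable (fun y => ‖M.gBeta y‖ ^ 2)
      (((volume : Measure ℝ).restrict (Set.Ioi 0)).prod surfaceMeasure) := by
    have hf : Integrable (fun k : Momentum => ‖M.g k‖ ^ 2 + M.β⁻¹ * (‖M.g k‖ ^ 2 / ‖k‖)) :=
      ((memLp_two_iff_integrable_sq_norm hg.1).1 hg).add (hIR.const_mul _)
    have h1 := integrable_polar hf
    -- As 1/(1 - exp(-v)) ≤ 1 + 1/v for v > 0, the density is an integrable function times a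
    -- measurable factor bounded by 1. This form also yields measurability.
    have h2 : Integrable (fun y : Conf =>
        ((1 - Real.exp (-M.β * y.1)) * (1 + M.β⁻¹ * |y.1|⁻¹))⁻¹ *
        (y.1 ^ 2 * (‖M.g (y.1 • (y.2 : Momentum))‖ ^ 2 +
          M.β⁻¹ * (‖M.g (y.1 • (y.2 : Momentum))‖ ^ 2 / ‖y.1 • (y.2 : Momentum)‖))))
        (((volume : Measure ℝ).restrict (Set.Ioi 0)).prod surfaceMeasure) := by
      refine h1.bdd_mul (c := 1) ?_ ?_
      · exact (by fun_prop : Measurable fun y : Conf =>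
          ((1 - Real.exp (-M.β * y.1)) * (1 + M.β⁻¹ * |y.1|⁻¹))⁻¹).aestronglyMeasurable
      · filter_upwards [hae] with y hy
        have hv : 0 < M.β * y.1 := by positivity
        have h3 : Real.exp (-M.β * y.1) ≤ (M.β * y.1 + 1)⁻¹ := by
          rw [neg_mul, Real.exp_neg]
          exact inv_anti₀ (by positivity) (Real.add_one_le_exp _)
        have h4 : (1 - (M.β * y.1 + 1)⁻¹) * (1 + M.β⁻¹ * |y.1|⁻¹) = 1 := by
          rw [abs_of_pos hy]
          field_simp
          ring
        have h5 : 1 ≤ (1 - Real.exp (-M.β * y.1)) * (1 + M.β⁻¹ * |y.1|⁻¹) := by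
          refine h4.symm.le.trans (mul_le_mul_of_nonneg_right (by linarith) ?_)
          positivity
        rw [norm_inv]
        exact inv_le_one_of_one_le₀ (h5.trans (le_abs_self _))
    refine h2.congr ?_
    filter_upwards [hae] with y hy
    obtain ⟨u, s⟩ := y
    have hs : ‖u • (s : Momentum)‖ = u := by
      rw [norm_smul, norm_eq_of_mem_sphere, mul_one, Real.norm_of_nonneg (le_of_lt hy)]
    have h1 : 0 < 1 - Real.exp (-M.β * u) := by
      rw [sub_pos, Real.exp_lt_one_iff]
      nlinarith
    have hu : 0 < u := hy
    simp only [hs, M.norm_gBeta_sq hβ hu s, abs_of_pos hu]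
    field_simp
  have hneg : Integrable (fun y => ‖M.gBeta y‖ ^ 2)
      (((volume : Measure ℝ).restrict (Set.Iio 0)).prod surfaceMeasure) := by
    have h1 : Integrable (fun y : Conf => Real.exp (-M.β * y.1) * ‖M.gBeta y‖ ^ 2)
        (((volume : Measure ℝ).restrict (Set.Ioi 0)).prod surfaceMeasure) := by
      refine hpos.bdd_mul (c := 1) ?_ ?_
      · exact (by fun_prop : Measurable fun y : Conf =>
          Real.exp (-M.β * y.1)).aestronglyMeasurable
      · filter_upwards [hae] with y hy
        rw [Real.norm_of_nonneg (Real.exp_pos _).le, Real.exp_le_one_iff]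
        nlinarith
    have h2 : MeasurePreserving (fun u : ℝ => -u) ((volume : Measure ℝ).restrict (Set.Ioi 0))
        ((volume : Measure ℝ).restrict (Set.Iio 0)) := by
      have := (Measure.measurePreserving_neg (volume : Measure ℝ)).restrict_preimage
        (measurableSet_Iio (a := (0 : ℝ)))
      simpa using this
    have h3 := h2.prod (MeasurePreserving.id surfaceMeasure)
    have h4 : MeasurableEmbedding (Prod.map (fun u : ℝ => -u) (id : S2 → S2)) :=
      (MeasurableEquiv.neg ℝ).measurableEmbedding.prodMap MeasurableEmbedding.id
    refine (h3.integrable_comp_emb h4).1 (h1.congr (Eventually.of_forall fun y => ?_))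
    exact (M.norm_gBeta_neg_sq y.1 y.2).symm
  have hsum := hneg.add_measure hpos
  rw [← Measure.add_prod] at hsum
  have h0 : (volume : Measure ℝ).restrict (Set.Iio 0) + (volume : Measure ℝ).restrict (Set.Ioi 0) =
      volume := by
    rw [Measure.restrict_congr_set Ioi_ae_eq_Ici, ← Set.compl_Iio, Measure.restrict_add_restrict_compl
      measurableSet_Iio]
  rwa [h0] at hsum

/-- The density `∫_{S²} |g_β(u, Σ)|² dΣ`. -/
def thermalDensity (u : ℝ) : ℝ := ∫ s : S2, ‖M.gBeta (u, s)‖ ^ 2 ∂surfaceMeasure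

theorem thermalDensity_of_pos (hβ : 0 < M.β) {u : ℝ} (hu : 0 < u) :
    M.thermalDensity u =
      2 / Real.pi * (1 - Real.exp (-M.β * u))⁻¹ * M.spectralDensity u := by
  simp only [thermalDensity, M.norm_gBeta_sq hβ hu, spectralDensity]
  rw [integral_const_mul]
  have := Real.pi_ne_zero
  field_simp

theorem thermalDensity_neg (u : ℝ) :
    M.thermalDensity (-u) = Real.exp (-M.β * u) * M.thermalDensity u := by
  simp only [thermalDensity, norm_gBeta_neg_sq]
  rw [integral_const_mul]

/-- Fubini over the sphere; ε > 0 bounds the resolvent by 1/ε. -/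
theorem resonanceIntegral_eq (hi : Integrable (fun y => ‖M.gBeta y‖ ^ 2) confMeasure)
    (a : ℝ) {ε : ℝ} (hε : 0 < ε) :
    M.resonanceIntegral a ε =
      ∫ u, (M.thermalDensity u : ℂ) * (((u + a : ℝ) : ℂ) + ε * Complex.I)⁻¹ := by
  rw [resonanceIntegral, confMeasure, integral_prod]
  · refine integral_congr_ae (Eventually.of_forall fun u => ?_)
    simp only [thermalDensity]
    rw [integral_mul_const, integral_complex_ofReal]
  · refine hi.ofReal.mul_bdd (c := ε⁻¹) ?_ (Eventually.of_forall fun y => ?_)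
    · exact (by fun_prop : Measurable fun y : Conf =>
        (((y.1 + a : ℝ) : ℂ) + ε * Complex.I)⁻¹).aestronglyMeasurable
    · rw [norm_inv]
      refine inv_anti₀ hε ?_
      have := Complex.abs_im_le_norm (((y.1 + a : ℝ) : ℂ) + ε * Complex.I)
      simpa [abs_of_pos hε] using this

/-- Regularity at -Δ is inherited from Δ through the KMS reflection; near Δ the density is a smooth
factor times J. -/
theorem differentiableAt_thermalDensity (hβ : 0 < M.β) (hΔ : 0 < M.gap)
    (hreg : ContDiffAt ℝ 1 M.spectralDensity M.gap) :
    DifferentiableAt ℝ M.thermalDensity M.gap ∧ DifferentiableAt ℝ M.thermalDensity (-M.gap) := by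
  have h1 : DifferentiableAt ℝ M.thermalDensity M.gap := by
    have h2 : M.thermalDensity =ᶠ[𝓝 M.gap] fun u =>
        2 / Real.pi * (1 - Real.exp (-M.β * u))⁻¹ * M.spectralDensity u := by
      filter_upwards [lt_mem_nhds hΔ] with u hu using M.thermalDensity_of_pos hβ hu
    have h3 : 1 - Real.exp (-M.β * M.gap) ≠ 0 := by
      refine (sub_pos.2 (Real.exp_lt_one_iff.2 ?_)).ne'
      nlinarith
    have h4 := hreg.differentiableAt one_ne_zero
    exact ((((by fun_prop : DifferentiableAt ℝ (fun u => 1 - Real.exp (-M.β * u)) M.gap).inv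
      h3).const_mul (2 / Real.pi)).mul h4).congr_of_eventuallyEq h2
  refine ⟨h1, ?_⟩
  have h2 : M.thermalDensity = fun u => Real.exp (M.β * u) * M.thermalDensity (-u) := by
    funext u
    have := M.thermalDensity_neg (-u)
    rwa [neg_neg, neg_mul_neg] at this
  rw [h2]
  have h3 : DifferentiableAt ℝ (fun u => M.thermalDensity (-u)) (-M.gap) := by
    refine DifferentiableAt.comp (g := M.thermalDensity) (-M.gap) ?_ differentiable_neg.differentiableAt
    simpa using h1
  exact (by fun_prop : DifferentiableAt ℝ (fun u => Real.exp (M.β * u)) (-M.gap)).mul h3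

/-- The width `T = π (h(Δ) + h(-Δ))`, with `h` the thermal density. -/
def width : ℝ := Real.pi * (M.thermalDensity M.gap + M.thermalDensity (-M.gap))

/-- The weight `η = 1 / (exp(βΔ) + 1)`. -/
def weight : ℝ := (Real.exp (M.β * M.gap) + 1)⁻¹

theorem weight_pos : 0 < M.weight := by
  unfold weight
  positivity

theorem weight_le_half (hβ : 0 < M.β) (hΔ : 0 < M.gap) : M.weight ≤ 1 / 2 := by
  have h : 1 ≤ Real.exp (M.β * M.gap) := Real.one_le_exp (by positivity)
  rw [weight, one_div]
  exact inv_anti₀ (by norm_num) (by linarith)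

theorem width_pos (hβ : 0 < M.β) (hΔ : 0 < M.gap) (hJ : 0 < M.spectralDensity M.gap) :
    0 < M.width := by
  have h1 : 0 < 1 - Real.exp (-M.β * M.gap) := by
    refine sub_pos.2 (Real.exp_lt_one_iff.2 ?_)
    nlinarith
  have h2 := Real.pi_pos
  have h3 : 0 < M.thermalDensity M.gap := by
    rw [M.thermalDensity_of_pos hβ hΔ]
    positivity
  rw [width, thermalDensity_neg]
  positivity

/-- Since h(-Δ) = exp(-βΔ) h(Δ) for the thermal density h, the weight η is the share of h(-Δ) in
h(Δ) + h(-Δ). -/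
theorem pi_mul_thermalDensity_neg : Real.pi * M.thermalDensity (-M.gap) = M.weight * M.width := by
  rw [width, weight, thermalDensity_neg, neg_mul, Real.exp_neg]
  have := Real.exp_pos (M.β * M.gap)
  field_simp

theorem pi_mul_thermalDensity : Real.pi * M.thermalDensity M.gap = (1 - M.weight) * M.width := by
  have h := M.pi_mul_thermalDensity_neg
  rw [sub_mul, one_mul, ← h, width]
  ring

/-- Boundary values of the resonance integrals at the two transition energies. -/
theorem exists_tendsto_resonanceIntegral (hβ : 0 < M.β) (hΔ : 0 < M.gap)
    (hg : MemLp M.g 2 (volume : Measure Momentum))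
    (hIR : Integrable (fun k : Momentum => ‖M.g k‖ ^ 2 / ‖k‖) volume)
    (hreg : ContDiffAt ℝ 1 M.spectralDensity M.gap) :
    ∃ A₁ A₂ : ℝ,
      Tendsto (M.resonanceIntegral (-M.gap)) (𝓝[>] 0)
        (𝓝 (A₁ - ((1 - M.weight) * M.width : ℝ) * Complex.I)) ∧
      Tendsto (M.resonanceIntegral M.gap) (𝓝[>] 0)
        (𝓝 (A₂ - (M.weight * M.width : ℝ) * Complex.I)) := by
  have hi := M.integrable_norm_gBeta_sq hβ hg hIR
  have hh : Integrable M.thermalDensity := Integrable.integral_prod_left hi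
  obtain ⟨hd₁, hd₂⟩ := M.differentiableAt_thermalDensity hβ hΔ hreg
  obtain ⟨A₁, h₁⟩ := exists_tendsto_integral_inv hh hd₁
  obtain ⟨A₂, h₂⟩ := exists_tendsto_integral_inv hh hd₂
  rw [pi_mul_thermalDensity] at h₁
  rw [pi_mul_thermalDensity_neg] at h₂
  refine ⟨A₁, A₂, h₁.congr' ?_, h₂.congr' ?_⟩
  · filter_upwards [self_mem_nhdsWithin] with ε hε
    rw [M.resonanceIntegral_eq hi _ hε]
    rfl
  · filter_upwards [self_mem_nhdsWithin] with ε hε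
    rw [M.resonanceIntegral_eq hi _ hε]
    simp only [sub_neg_eq_add]

end Model

end ThreeLevel

end
noncomputable section

namespace ThreeLevel

/-! ### Eigenprojections of the level shift operators -/

theorem sum_mult_zero {α : Type*} [AddCommMonoid α] (f : Fin (mult 0) → α) :
    ∑ s, f s = f (0 : Fin 5) + f (1 : Fin 5) + f (2 : Fin 5) + f (3 : Fin 5) + f (4 : Fin 5) :=
  Fin.sum_univ_five f

theorem sum_mult_one {α : Type*} [AddCommMonoid α] (f : Fin (mult 1) → α) :
    ∑ s, f s = f (0 : Fin 2) + f (1 : Fin 2) :=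
  Fin.sum_univ_two f

theorem sum_mult_two {α : Type*} [AddCommMonoid α] (f : Fin (mult 2) → α) :
    ∑ s, f s = f (0 : Fin 2) + f (1 : Fin 2) :=
  Fin.sum_univ_two f

/-- The sectors of pairs of levels with a given energy difference. -/
def sector : Fin 3 → Fin 3 × Fin 3 → Prop :=
  ![fun q => q.1 = 0 ↔ q.2 = 0, fun q => q.1 = 0 ∧ q.2 ≠ 0, fun q => q.1 ≠ 0 ∧ q.2 = 0]

/-- The tensor product of two vectors of `ℂ³`. -/
def tens (a b : Fin 3 → ℂ) (q : Fin 3 × Fin 3) : ℂ := a q.1 * b q.2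

/-- The upper level `φ₁`. -/
def upper : Fin 3 → ℂ := ![1, 0, 0]

/-- The symmetric combination `φ₂ + φ₃`. -/
def symm : Fin 3 → ℂ := ![0, 1, 1]

/-- The antisymmetric combination `φ₂ - φ₃`. -/
def anti : Fin 3 → ℂ := ![0, 1, -1]

/-- Right eigenvectors at the eigenvalue `0`. -/
def rightDiag (η : ℝ) : Fin 5 → Fin 3 × Fin 3 → ℂ :=
  ![tens upper upper + (1 / 2 : ℂ) • tens symm symm, (1 / 2 : ℂ) • tens anti anti,
    (1 - η : ℂ) • tens upper upper - (η / 2 : ℂ) • tens symm symm,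
    (1 / 2 : ℂ) • tens symm anti, (1 / 2 : ℂ) • tens anti symm]

/-- Left eigenvectors at the eigenvalue `0`. -/
def leftDiag (η : ℝ) : Fin 5 → Fin 3 × Fin 3 → ℂ :=
  ![(η : ℂ) • tens upper upper + ((1 - η) / 2 : ℂ) • tens symm symm,
    (1 / 2 : ℂ) • tens anti anti, tens upper upper - (1 / 2 : ℂ) • tens symm symm,
    (1 / 2 : ℂ) • tens symm anti, (1 / 2 : ℂ) • tens anti symm]

/-- Right eigenvectors at the eigenvalue `Δ`. -/
def rightUp : Fin 2 → Fin 3 × Fin 3 → ℂ :=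
  ![(1 / 2 : ℂ) • tens upper symm, (1 / 2 : ℂ) • tens upper anti]

/-- Left eigenvectors at the eigenvalue `Δ`. -/
def leftUp : Fin 2 → Fin 3 × Fin 3 → ℂ := ![tens upper symm, tens upper anti]

/-- Right eigenvectors at the eigenvalue `-Δ`. -/
def rightDown : Fin 2 → Fin 3 × Fin 3 → ℂ :=
  ![(1 / 2 : ℂ) • tens symm upper, (1 / 2 : ℂ) • tens anti upper]

/-- Left eigenvectors at the eigenvalue `-Δ`. -/
def leftDown : Fin 2 → Fin 3 × Fin 3 → ℂ := ![tens symm upper, tens anti upper]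

/-- Right eigenvectors of the level shift operators. -/
def modeRight (η : ℝ) : (j : Fin 3) → Fin (mult j) → Fin 3 × Fin 3 → ℂ
  | 0 => rightDiag η
  | 1 => rightUp
  | 2 => rightDown

/-- Left eigenvectors of the level shift operators, dual to `modeRight`. -/
def modeLeft (η : ℝ) : (j : Fin 3) → Fin (mult j) → Fin 3 × Fin 3 → ℂ
  | 0 => leftDiag η
  | 1 => leftUp
  | 2 => leftDown

theorem modeLeft_dotProduct_modeRight (η : ℝ) (j : Fin 3) (s s' : Fin (mult j)) :
    modeLeft η j s ⬝ᵥ modeRight η j s' = if s = s' then 1 else 0 := by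
  have h0 : ∀ s s' : Fin 5, leftDiag η s ⬝ᵥ rightDiag η s' = if s = s' then 1 else 0 := by
    intro s s'
    fin_cases s <;> fin_cases s' <;>
      simp [leftDiag, rightDiag, dotProduct, Fintype.sum_prod_type, Fin.sum_univ_three, tens,
        upper, symm, anti] <;> ring
  have h1 : ∀ s s' : Fin 2, leftUp s ⬝ᵥ rightUp s' = if s = s' then 1 else 0 := by
    intro s s'
    fin_cases s <;> fin_cases s' <;>
      simp [leftUp, rightUp, dotProduct, Fintype.sum_prod_type, Fin.sum_univ_three, tens,
        upper, symm, anti] <;> norm_num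
  have h2 : ∀ s s' : Fin 2, leftDown s ⬝ᵥ rightDown s' = if s = s' then 1 else 0 := by
    intro s s'
    fin_cases s <;> fin_cases s' <;>
      simp [leftDown, rightDown, dotProduct, Fintype.sum_prod_type, Fin.sum_univ_three, tens,
        upper, symm, anti] <;> norm_num
  match j with
  | 0 => exact h0 s s'
  | 1 => exact h1 s s'
  | 2 => exact h2 s s'

theorem norm_modeRight_le {η : ℝ} (h0 : 0 ≤ η) (h1 : η ≤ 1) (j : Fin 3) (s : Fin (mult j))
    (q : Fin 3 × Fin 3) : ‖modeRight η j s q‖ ≤ 1 := by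
  have hη : ‖(η : ℂ) / 2‖ ≤ 1 := by
    rw [norm_div, Complex.norm_real, Real.norm_of_nonneg h0]
    norm_num
    linarith
  have hη' : ‖(1 - η : ℂ)‖ ≤ 1 := by
    rw [← Complex.ofReal_one, ← Complex.ofReal_sub, Complex.norm_real,
      Real.norm_of_nonneg (by linarith)]
    linarith
  have e0 : ∀ s : Fin 5, ‖rightDiag η s q‖ ≤ 1 := by
    obtain ⟨a, b⟩ := q
    intro s
    fin_cases s <;> fin_cases a <;> fin_cases b <;>
      simp [rightDiag, tens, upper, symm, anti] <;>
      first
        | exact hη'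
        | simpa using hη
        | norm_num
  have e1 : ∀ s : Fin 2, ‖rightUp s q‖ ≤ 1 := by
    obtain ⟨a, b⟩ := q
    intro s
    fin_cases s <;> fin_cases a <;> fin_cases b <;>
      simp [rightUp, tens, upper, symm, anti] <;> norm_num
  have e2 : ∀ s : Fin 2, ‖rightDown s q‖ ≤ 1 := by
    obtain ⟨a, b⟩ := q
    intro s
    fin_cases s <;> fin_cases a <;> fin_cases b <;>
      simp [rightDown, tens, upper, symm, anti] <;> norm_num
  match j with
  | 0 => exact e0 s
  | 1 => exact e1 s
  | 2 => exact e2 s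

theorem norm_modeLeft_le {η : ℝ} (h0 : 0 ≤ η) (h1 : η ≤ 1) (j : Fin 3) (s : Fin (mult j))
    (q : Fin 3 × Fin 3) : ‖modeLeft η j s q‖ ≤ 1 := by
  have hη : ‖(η : ℂ)‖ ≤ 1 := by
    rwa [Complex.norm_real, Real.norm_of_nonneg h0]
  have hη' : ‖(1 - η : ℂ) / 2‖ ≤ 1 := by
    rw [← Complex.ofReal_one, ← Complex.ofReal_sub, norm_div, Complex.norm_real,
      Real.norm_of_nonneg (by linarith)]
    norm_num
    linarith
  have e0 : ∀ s : Fin 5, ‖leftDiag η s q‖ ≤ 1 := by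
    obtain ⟨a, b⟩ := q
    intro s
    fin_cases s <;> fin_cases a <;> fin_cases b <;>
      simp [leftDiag, tens, upper, symm, anti] <;>
      first
        | simpa using hη'
        | simpa using hη
        | norm_num
  have e1 : ∀ s : Fin 2, ‖leftUp s q‖ ≤ 1 := by
    obtain ⟨a, b⟩ := q
    intro s
    fin_cases s <;> fin_cases a <;> fin_cases b <;> simp [leftUp, tens, upper, symm, anti]
  have e2 : ∀ s : Fin 2, ‖leftDown s q‖ ≤ 1 := by
    obtain ⟨a, b⟩ := q
    intro s
    fin_cases s <;> fin_cases a <;> fin_cases b <;> simp [leftDown, tens, upper, symm, anti]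
  match j with
  | 0 => exact e0 s
  | 1 => exact e1 s
  | 2 => exact e2 s

namespace Model

variable (M : Model)

/-- Positivity of Δ keeps 0, Δ and -Δ distinct, so the eigenspaces can be read off from the indices.
-/
theorem level_sub_eq_bohr_iff (hΔ : 0 < M.gap) (j : Fin 3) (q : Fin 3 × Fin 3) :
    M.level 0 q.1 - M.level 0 q.2 = M.bohr j ↔ sector j q := by
  obtain ⟨a, b⟩ := q
  unfold gap at hΔ
  have h1 : M.E₀ - M.E ≠ 0 := hΔ.ne'
  have h2 : M.E - M.E₀ ≠ 0 := by linarith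
  have h3 : M.E₀ - M.E ≠ M.E - M.E₀ := by linarith
  have h4 : M.E - M.E₀ ≠ M.E₀ - M.E := by linarith
  fin_cases j <;> fin_cases a <;> fin_cases b <;> simp [level, bohr, gap, sector, *, Ne.symm]

end Model
end ThreeLevel

end
noncomputable section

namespace ThreeLevel

/-! ### Diagonalization of the level shift operators -/

/-- Eigenvalues of the level shift operator at `0`, in terms of the boundary values `X`, `Y` of the
resonance integrals at the transition energies `-Δ`, `Δ`. -/
def energyDiag (lam : ℝ) (X Y : ℂ) : Fin 5 → ℂ :=
  ![0, 0, -(lam ^ 2) * (X + Y - (starRingEnd ℂ) X - (starRingEnd ℂ) Y), -(lam ^ 2) * Y,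
    lam ^ 2 * (starRingEnd ℂ) Y]

/-- Eigenvalues of the level shift operator at `Δ`. -/
def energyUp (lam : ℝ) (X Y : ℂ) : Fin 2 → ℂ :=
  ![-(lam ^ 2) * (X - (starRingEnd ℂ) Y), -(lam ^ 2) * X]

/-- Eigenvalues of the level shift operator at `-Δ`. -/
def energyDown (lam : ℝ) (X Y : ℂ) : Fin 2 → ℂ :=
  ![-(lam ^ 2) * (Y - (starRingEnd ℂ) X), lam ^ 2 * (starRingEnd ℂ) X]

/-- The second-order contributions to the resonance energies. -/
def modeShift (lam : ℝ) (X Y : ℂ) : (j : Fin 3) → Fin (mult j) → ℂ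
  | 0 => energyDiag lam X Y
  | 1 => energyUp lam X Y
  | 2 => energyDown lam X Y

/-- The second-order part of the level shift operators. -/
def shiftMat (lam : ℝ) (X Y : ℂ) : Mat9 := fun q r =>
  -(lam ^ 2 / 2) *
    ∑ m, (G q.1 m * ((if q.1 = 0 then X else Y) * couplingMat r m q.2) +
      G q.2 m * ((starRingEnd ℂ) (if q.2 = 0 then X else Y) * couplingMat r q.1 m))

-- Completeness of the biorthogonal modes within each sector.
open scoped Classical in
theorem sum_modes (η : ℝ) (j : Fin 3) (q r : Fin 3 × Fin 3) :
    ∑ s, modeRight η j s q * modeLeft η j s r = if sector j q ∧ q = r then 1 else 0 := by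
  obtain ⟨a, b⟩ := q
  obtain ⟨c, d⟩ := r
  match j with
  | 0 =>
    rw [sum_mult_zero]
    change (rightDiag η 0 (a, b) * leftDiag η 0 (c, d)) +
      (rightDiag η 1 (a, b) * leftDiag η 1 (c, d)) +
      (rightDiag η 2 (a, b) * leftDiag η 2 (c, d)) +
      (rightDiag η 3 (a, b) * leftDiag η 3 (c, d)) +
      (rightDiag η 4 (a, b) * leftDiag η 4 (c, d)) = _
    fin_cases a <;> fin_cases b <;> fin_cases c <;> fin_cases d <;>
      simp [rightDiag, leftDiag, sector, tens, upper, symm, anti] <;> ring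
  | 1 =>
    rw [sum_mult_one]
    change (rightUp 0 (a, b) * leftUp 0 (c, d)) +
      (rightUp 1 (a, b) * leftUp 1 (c, d)) = _
    fin_cases a <;> fin_cases b <;> fin_cases c <;> fin_cases d <;>
      simp [rightUp, leftUp, sector, tens, upper, symm, anti] <;> ring
  | 2 =>
    rw [sum_mult_two]
    change (rightDown 0 (a, b) * leftDown 0 (c, d)) +
      (rightDown 1 (a, b) * leftDown 1 (c, d)) = _
    fin_cases a <;> fin_cases b <;> fin_cases c <;> fin_cases d <;>
      simp [rightDown, leftDown, sector, tens, upper, symm, anti] <;> ring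

-- `hX` and `hY` are detailed balance for the imaginary parts. They are needed only in sector 0,
-- whose bright population modes depend on η; in the other two sectors the identity holds for
-- arbitrary X and Y.
set_option maxHeartbeats 2000000 in
open scoped Classical in
theorem sum_modeShift_modes {η : ℝ} {X Y : ℂ} (lam : ℝ)
    (hX : X - (starRingEnd ℂ) X = (1 - η) * (X + Y - (starRingEnd ℂ) X - (starRingEnd ℂ) Y))
    (hY : Y - (starRingEnd ℂ) Y = η * (X + Y - (starRingEnd ℂ) X - (starRingEnd ℂ) Y))
    (j : Fin 3) (q r : Fin 3 × Fin 3) :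
    ∑ s, modeShift lam X Y j s * (modeRight η j s q * modeLeft η j s r) =
      if sector j q ∧ sector j r then shiftMat lam X Y q r else 0 := by
  obtain ⟨a, b⟩ := q
  obtain ⟨c, d⟩ := r
  match j with
  | 0 =>
    rw [sum_mult_zero]
    change energyDiag lam X Y 0 * (rightDiag η 0 (a, b) * leftDiag η 0 (c, d)) +
      energyDiag lam X Y 1 * (rightDiag η 1 (a, b) * leftDiag η 1 (c, d)) +
      energyDiag lam X Y 2 * (rightDiag η 2 (a, b) * leftDiag η 2 (c, d)) +
      energyDiag lam X Y 3 * (rightDiag η 3 (a, b) * leftDiag η 3 (c, d)) +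
      energyDiag lam X Y 4 * (rightDiag η 4 (a, b) * leftDiag η 4 (c, d)) = _
    fin_cases a <;> fin_cases b <;> fin_cases c <;> fin_cases d <;>
      simp [energyDiag, rightDiag, leftDiag, sector, shiftMat, tens, upper, symm, anti, G,
        couplingMat, Fin.sum_univ_three] <;> first
          | done
          | ring1
          | linear_combination (-(lam : ℂ) ^ 2) * hX
          | linear_combination (lam : ℂ) ^ 2 * hX
          | linear_combination (-(lam : ℂ) ^ 2 / 2) * hX
          | linear_combination (lam : ℂ) ^ 2 / 2 * hX
          | linear_combination (-(lam : ℂ) ^ 2 / 2) * hY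
          | linear_combination (lam : ℂ) ^ 2 / 2 * hY
          | linear_combination (-(lam : ℂ) ^ 2 / 4) * hY
          | linear_combination (lam : ℂ) ^ 2 / 4 * hY
  | 1 =>
    rw [sum_mult_one]
    change energyUp lam X Y 0 * (rightUp 0 (a, b) * leftUp 0 (c, d)) +
      energyUp lam X Y 1 * (rightUp 1 (a, b) * leftUp 1 (c, d)) = _
    fin_cases a <;> fin_cases b <;> fin_cases c <;> fin_cases d <;>
      simp [energyUp, rightUp, leftUp, sector, shiftMat, tens, upper, symm, anti, G,
        couplingMat, Fin.sum_univ_three] <;> ring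
  | 2 =>
    rw [sum_mult_two]
    change energyDown lam X Y 0 * (rightDown 0 (a, b) * leftDown 0 (c, d)) +
      energyDown lam X Y 1 * (rightDown 1 (a, b) * leftDown 1 (c, d)) = _
    fin_cases a <;> fin_cases b <;> fin_cases c <;> fin_cases d <;>
      simp [energyDown, rightDown, leftDown, sector, shiftMat, tens, upper, symm, anti, G,
        couplingMat, Fin.sum_univ_three] <;> ring

end ThreeLevel

end
-- Limits of the level shift operators, and independence of the dynamics from the diagonal form
noncomputable section

namespace ThreeLevel

namespace Model

variable (M : Model)

/-- The explicit diagonal form of the level shift operators. -/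
def levelShiftMat (lam : ℝ) (X Y : ℂ) (j : Fin 3) : Mat9 :=
  ∑ s, ((M.bohr j : ℂ) + modeShift lam X Y j s) •
    Matrix.vecMulVec (modeRight M.weight j s) (modeLeft M.weight j s)

open scoped Classical in
theorem sum_modeProj_apply (j : Fin 3) (q r : Fin 3 × Fin 3) :
    (∑ s, Matrix.vecMulVec (modeRight M.weight j s) (modeLeft M.weight j s)) q r =
      if sector j q ∧ q = r then 1 else 0 := by
  rw [← sum_modes M.weight j q r, Matrix.sum_apply]
  rfl

open scoped Classical in
theorem levelShiftMat_apply {X Y : ℂ} (lam : ℝ)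
    (hX : X - (starRingEnd ℂ) X =
      (1 - M.weight) * (X + Y - (starRingEnd ℂ) X - (starRingEnd ℂ) Y))
    (hY : Y - (starRingEnd ℂ) Y = M.weight * (X + Y - (starRingEnd ℂ) X - (starRingEnd ℂ) Y))
    (j : Fin 3) (q r : Fin 3 × Fin 3) :
    M.levelShiftMat lam X Y j q r =
      if sector j q ∧ sector j r then
        (M.bohr j : ℂ) * (if q = r then 1 else 0) + shiftMat lam X Y q r
      else 0 := by
  have h1 := sum_modes M.weight j q r
  have h2 := sum_modeShift_modes lam hX hY j q r
  simp only [levelShiftMat, Matrix.sum_apply, Matrix.smul_apply, Matrix.vecMulVec_apply,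
    smul_eq_mul, add_mul, Finset.sum_add_distrib]
  rw [← Finset.mul_sum, h1, h2]
  by_cases hq : sector j q
  · by_cases hr : sector j r
    · simp [hq, hr]
    · have : q ≠ r := by
        rintro rfl
        exact hr hq
      simp [hr, this]
  · simp [hq]

/-- `G` connects φ₁ only with the two lower levels, so the only transition energies are -Δ (from φ₁)
and Δ (to φ₁). -/
theorem tendsto_resonanceIntegral_level {X Y : ℂ}
    (hX : Tendsto (M.resonanceIntegral (-M.gap)) (𝓝[>] 0) (𝓝 X))
    (hY : Tendsto (M.resonanceIntegral M.gap) (𝓝[>] 0) (𝓝 Y)) {k m : Fin 3} (h : G k m ≠ 0) :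
    Tendsto (M.resonanceIntegral (M.level 0 m - M.level 0 k)) (𝓝[>] 0)
      (𝓝 (if k = 0 then X else Y)) := by
  have h1 : -M.gap = M.E - M.E₀ := by simp [gap]
  rw [h1] at hX
  unfold gap at hY
  fin_cases k <;> fin_cases m <;> simp [G] at h <;> simpa [level] using by assumption

theorem tendsto_regLevelShift (hΔ : 0 < M.gap) {X Y : ℂ} (lam : ℝ)
    (hX : Tendsto (M.resonanceIntegral (-M.gap)) (𝓝[>] 0) (𝓝 X))
    (hY : Tendsto (M.resonanceIntegral M.gap) (𝓝[>] 0) (𝓝 Y))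
    (hX' : X - (starRingEnd ℂ) X =
      (1 - M.weight) * (X + Y - (starRingEnd ℂ) X - (starRingEnd ℂ) Y))
    (hY' : Y - (starRingEnd ℂ) Y = M.weight * (X + Y - (starRingEnd ℂ) X - (starRingEnd ℂ) Y))
    (j : Fin 3) :
    Tendsto (M.regLevelShift 0 lam j) (𝓝[>] 0) (𝓝 (M.levelShiftMat lam X Y j)) := by
  classical
  refine tendsto_pi_nhds.2 fun q => tendsto_pi_nhds.2 fun r => ?_
  rw [M.levelShiftMat_apply lam hX' hY']
  simp only [regLevelShift_apply, M.level_sub_eq_bohr_iff hΔ]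
  by_cases h : sector j q ∧ sector j r
  swap
  · simp [h]
  simp only [h, and_self, if_true]
  rw [shiftMat, neg_mul, ← sub_eq_add_neg]
  refine tendsto_const_nhds.sub (Tendsto.const_mul _ (tendsto_finsetSum _ fun m _ => ?_))
  refine Tendsto.add ?_ ?_
  -- A vanishing `G` entry goes with energy difference 0, where no limit of the resonance integral
  -- is available; the zero factor discards it.
  · by_cases hG : G q.1 m = 0
    · simp [hG]
    · exact ((M.tendsto_resonanceIntegral_level hX hY hG).mul_const _).const_mul _
  · by_cases hG : G q.2 m = 0
    · simp [hG]
    · exact (((Complex.continuous_conj.tendsto _).comp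
        (M.tendsto_resonanceIntegral_level hX hY hG)).mul_const _).const_mul _

theorem spectralProj_eq_sum (hΔ : 0 < M.gap) (j : Fin 3) :
    ∑ s, Matrix.vecMulVec (modeRight M.weight j s) (modeLeft M.weight j s) =
      M.spectralProj j := by
  classical
  ext q r
  rw [sum_modeProj_apply]
  simp only [spectralProj, Matrix.diagonal_apply, M.level_sub_eq_bohr_iff hΔ]
  by_cases h : q = r <;> simp [h]

/-- The resonances of the explicit diagonal form. -/
def resonancesOfBoundary (hΔ : 0 < M.gap) {X Y : ℂ} (lam : ℝ)
    (h : ∀ j, M.levelShift 0 lam j = M.levelShiftMat lam X Y j) : M.Resonances 0 lam where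
  energy j s := (M.bohr j : ℂ) + modeShift lam X Y j s
  proj j s := Matrix.vecMulVec (modeRight M.weight j s) (modeLeft M.weight j s)
  rank_proj j s := by
    refine le_antisymm (Matrix.rank_vecMulVec_le _ _) ?_
    -- Rank 0 would make the projection vanish, yet it fixes its right eigenvector, which is nonzero
    -- because it pairs to 1 with the left one.
    rw [Nat.one_le_iff_ne_zero]
    intro h0
    have h1 := modeLeft_dotProduct_modeRight M.weight j s s
    rw [if_pos rfl] at h1
    have h2 := LinearMap.range_eq_bot.1 (Submodule.finrank_eq_zero.1 h0)
    have h3 := LinearMap.congr_fun h2 (modeRight M.weight j s)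
    rw [Matrix.mulVecLin_apply, Matrix.vecMulVec_mulVec, h1] at h3
    have h4 : modeRight M.weight j s = 0 := by simpa using h3
    simp [h4] at h1
  proj_mul_proj j s s' := by
    rw [Matrix.vecMulVec_mul_vecMulVec, modeLeft_dotProduct_modeRight]
    by_cases hs : s = s' <;> simp [hs]
  sum_proj j := M.spectralProj_eq_sum hΔ j
  levelShift_eq j := h j

namespace Resonances

variable {M} {σ lam : ℝ}

theorem levelShift_mul_proj (D : M.Resonances σ lam) (j : Fin 3) (s : Fin (mult j)) :
    M.levelShift σ lam j * D.proj j s = D.energy j s • D.proj j s := by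
  simp [D.levelShift_eq, Finset.sum_mul, D.proj_mul_proj]

theorem proj_mul_levelShift (D : M.Resonances σ lam) (j : Fin 3) (s : Fin (mult j)) :
    D.proj j s * M.levelShift σ lam j = D.energy j s • D.proj j s := by
  simp [D.levelShift_eq, Finset.mul_sum, D.proj_mul_proj]

theorem spectralProj_mul_proj (D : M.Resonances σ lam) (j : Fin 3) (s : Fin (mult j)) :
    M.spectralProj j * D.proj j s = D.proj j s := by
  simp [← D.sum_proj, Finset.sum_mul, D.proj_mul_proj]

theorem proj_mul_spectralProj (D : M.Resonances σ lam) (j : Fin 3) (s : Fin (mult j)) :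
    D.proj j s * M.spectralProj j = D.proj j s := by
  simp [← D.sum_proj, Finset.mul_sum, D.proj_mul_proj]

/-- A function of the level shift operator does not depend on the chosen diagonal form. -/
theorem sum_smul_proj_eq (D D' : M.Resonances σ lam) (f : ℂ → ℂ) (j : Fin 3) :
    ∑ s, f (D.energy j s) • D.proj j s = ∑ s, f (D'.energy j s) • D'.proj j s := by
  -- Evaluating P Λ P' from both sides shows that two projections with nonzero product carry the
  -- same eigenvalue.
  have key : ∀ s s', f (D.energy j s) • (D.proj j s * D'.proj j s') =
      f (D'.energy j s') • (D.proj j s * D'.proj j s') := by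
    intro s s'
    have h : D.energy j s • (D.proj j s * D'.proj j s') =
        D'.energy j s' • (D.proj j s * D'.proj j s') := by
      rw [← Matrix.smul_mul, ← D.proj_mul_levelShift, Matrix.mul_assoc, D'.levelShift_mul_proj,
        Matrix.mul_smul]
    by_cases h0 : D.proj j s * D'.proj j s' = 0
    · simp [h0]
    · rw [smul_left_injective ℂ h0 h]
  have h1 : ∀ s, D.proj j s = ∑ s', D.proj j s * D'.proj j s' := fun s => by
    rw [← Finset.mul_sum, D'.sum_proj, D.proj_mul_spectralProj]
  have h2 : ∀ s', D'.proj j s' = ∑ s, D.proj j s * D'.proj j s' := fun s' => by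
    rw [← Finset.sum_mul, D.sum_proj, D'.spectralProj_mul_proj]
  calc ∑ s, f (D.energy j s) • D.proj j s
      = ∑ s, ∑ s', f (D.energy j s) • (D.proj j s * D'.proj j s') :=
        Finset.sum_congr rfl fun s _ => by rw [← Finset.smul_sum, ← h1]
    _ = ∑ s', ∑ s, f (D'.energy j s') • (D.proj j s * D'.proj j s') := by
        rw [Finset.sum_comm]
        exact Finset.sum_congr rfl fun s' _ => Finset.sum_congr rfl fun s _ => key s s'
    _ = _ := Finset.sum_congr rfl fun s' _ => by rw [← Finset.smul_sum, ← h2]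

theorem opX_zero : M.opX 0 = 1 := by
  have h : M.partition 0 ≠ 0 := by
    refine (Finset.sum_pos (fun k _ => Real.exp_pos _) Finset.univ_nonempty).ne'
  have h2 : (![1, 1, 1] : Fin 3 → ℂ) = 1 := by
    ext i
    fin_cases i <;> rfl
  simp [opX, h, h2]

open scoped MatrixOrder in
/-- In terms of the density matrix, `⟨ψ_S, B w⟩ = √3 ∑ ρ_{lk} w_{kl}`. -/
theorem star_psiS_dotProduct_opB {ρ : Mat3} (hρ : ρ.PosSemidef) (w : Fin 3 × Fin 3 → ℂ) :
    star (psiS ρ) ⬝ᵥ (opB ρ *ᵥ w) = ((√3 : ℝ) : ℂ) * ∑ q, ρ q.2 q.1 * w q := by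
  have h0 : (0 : Mat3) ≤ ρ := hρ.nonneg
  have h1 : sqrtMat ρ * sqrtMat ρ = ρ := CFC.sqrt_mul_sqrt_self ρ h0
  have h2 : (sqrtMat ρ)ᴴ = sqrtMat ρ :=
    (Matrix.nonneg_iff_posSemidef.1 (CFC.sqrt_nonneg ρ)).isHermitian
  have h3 : ∀ i j, (starRingEnd ℂ) (sqrtMat ρ i j) = sqrtMat ρ j i := fun i j => by
    conv_rhs => rw [← h2]
    rfl
  conv_rhs => rw [← h1]
  simp [opB, Matrix.mul_apply, dotProduct, Matrix.mulVec, Fintype.sum_prod_type,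
    Fin.sum_univ_three, psiS, Matrix.kroneckerMap_apply, Matrix.one_apply, h3]
  ring

/-- The factors √3 of `opB` and `psiRef` cancel, and the initial vector enters only through ρ. What
remains of `D` is exp(itΛ_e), ready for `sum_smul_proj_eq`. -/
theorem expectation_eq (D : M.Resonances 0 lam) (t : ℝ) {ρ : Mat3} (hρ : ρ.PosSemidef) (A : Mat3) :
    D.expectation t ρ A = ∑ j, ∑ q, ρ q.2 q.1 *
      ((∑ s, Complex.exp (Complex.I * t * D.energy j s) • D.proj j s) *ᵥ fun q => A q.1 q.2) q := by
  have h3 : ((√3 : ℝ) : ℂ) ≠ 0 := by simp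
  have hA : (A ⊗ₖ (1 : Mat3)) *ᵥ psiRef = ((√3 : ℝ) : ℂ)⁻¹ • fun q => A q.1 q.2 := by
    ext ⟨k, l⟩
    simp only [Matrix.mulVec, dotProduct, Fintype.sum_prod_type, Matrix.kroneckerMap_apply,
      Matrix.one_apply, psiRef, Pi.smul_apply, smul_eq_mul]
    simp [mul_comm]
  refine Finset.sum_congr rfl fun j _ => ?_
  simp only [chi, chiTilde, opX_zero, Matrix.one_mul, Matrix.mul_one, hA, Matrix.mulVec_smul,
    star_psiS_dotProduct_opB hρ, dotProduct_smul, smul_eq_mul, Matrix.sum_mulVec,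
    Matrix.smul_mulVec, Finset.sum_apply, Pi.smul_apply]
  simp only [Finset.mul_sum]
  rw [Finset.sum_comm]
  refine Finset.sum_congr rfl fun q _ => Finset.sum_congr rfl fun s _ => ?_
  field_simp

end Resonances

end Model
end ThreeLevel

end
noncomputable section

namespace ThreeLevel

/-! ### Density matrices and the trace norm -/

/-- Each squared singular value is at most tr(A*A) = ∑ |A_ij|², hence at most the square of ∑
|A_ij|. -/
theorem traceNorm_le (A : Mat3) : traceNorm A ≤ 3 * ∑ i, ∑ j, ‖A i j‖ := by
  have hH := Matrix.isHermitian_conjTranspose_mul_self A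
  have hP := Matrix.posSemidef_conjTranspose_mul_self A
  set S : ℝ := ∑ i, ∑ j, ‖A i j‖ with hS
  have hS0 : 0 ≤ S := by positivity
  have htr : ∑ i, hH.eigenvalues i = ∑ i, ∑ j, ‖A i j‖ ^ 2 := by
    have h1 := hH.trace_eq_sum_eigenvalues
    have h2 : (Aᴴ * A).trace = ((∑ i, ∑ j, ‖A i j‖ ^ 2 : ℝ) : ℂ) := by
      simp only [Matrix.trace, Matrix.diag_apply, Matrix.mul_apply, Matrix.conjTranspose_apply]
      rw [Finset.sum_comm]
      push_cast
      refine Finset.sum_congr rfl fun i _ => Finset.sum_congr rfl fun j _ => ?_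
      rw [mul_comm]
      exact Complex.mul_conj' _
    rw [h2] at h1
    exact Complex.ofReal_injective ((Complex.ofReal_sum _ _).trans h1.symm)
  have hle : ∑ i, ∑ j, ‖A i j‖ ^ 2 ≤ S ^ 2 := by
    rw [sq S]
    conv_rhs => rw [hS, Finset.sum_mul]
    refine Finset.sum_le_sum fun i _ => ?_
    rw [Finset.sum_mul]
    refine Finset.sum_le_sum fun j _ => ?_
    rw [sq]
    refine mul_le_mul_of_nonneg_left ?_ (norm_nonneg _)
    exact (Finset.single_le_sum (f := fun j => ‖A i j‖) (fun _ _ => norm_nonneg _)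
      (Finset.mem_univ j)).trans (Finset.single_le_sum (f := fun i => ∑ j, ‖A i j‖)
        (fun _ _ => Finset.sum_nonneg fun _ _ => norm_nonneg _) (Finset.mem_univ i))
  have h : ∀ i, √(hH.eigenvalues i) ≤ S := fun i => by
    refine Real.sqrt_le_iff.2 ⟨hS0, ?_⟩
    refine le_trans ?_ (htr.le.trans hle)
    exact Finset.single_le_sum (f := hH.eigenvalues) (fun i _ => hP.eigenvalues_nonneg i)
      (Finset.mem_univ i)
  calc traceNorm A ≤ ∑ _i : Fin 3, S := Finset.sum_le_sum fun i _ => h i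
    _ = 3 * S := by simp

-- The square root of ρ has Hilbert-Schmidt norm 1, so each entry of ρ is a sum of three products of
-- numbers of modulus at most 1. The bound is crude, but uniform in ρ.
open scoped MatrixOrder in
theorem IsDensity.norm_apply_le {ρ : Mat3} (hρ : IsDensity ρ) (i j : Fin 3) : ‖ρ i j‖ ≤ 3 := by
  have h0 : (0 : Mat3) ≤ ρ := hρ.1.nonneg
  have h1 : sqrtMat ρ * sqrtMat ρ = ρ := CFC.sqrt_mul_sqrt_self ρ h0
  have h2 : (sqrtMat ρ)ᴴ = sqrtMat ρ :=
    (Matrix.nonneg_iff_posSemidef.1 (CFC.sqrt_nonneg ρ)).isHermitian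
  have htr : ∑ i, ∑ j, ‖sqrtMat ρ i j‖ ^ 2 = 1 := by
    have h4 : (sqrtMat ρ * (sqrtMat ρ)ᴴ).trace = 1 := by rw [h2, h1, hρ.2]
    simp only [Matrix.trace, Matrix.diag_apply, Matrix.mul_apply,
      Matrix.conjTranspose_apply] at h4
    have h5 : ∀ i j, sqrtMat ρ i j * star (sqrtMat ρ i j) = ((‖sqrtMat ρ i j‖ ^ 2 : ℝ) : ℂ) :=
      fun i j => by
        push_cast
        exact Complex.mul_conj' _
    simp only [h5] at h4
    exact_mod_cast h4
  have hle : ∀ i j, ‖sqrtMat ρ i j‖ ≤ 1 := fun i j => by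
    refine (sq_le_one_iff₀ (norm_nonneg _)).1 ?_
    rw [← htr]
    exact (Finset.single_le_sum (f := fun j => ‖sqrtMat ρ i j‖ ^ 2) (fun _ _ => sq_nonneg _)
      (Finset.mem_univ j)).trans (Finset.single_le_sum (f := fun i => ∑ j, ‖sqrtMat ρ i j‖ ^ 2)
        (fun _ _ => Finset.sum_nonneg fun _ _ => sq_nonneg _) (Finset.mem_univ i))
  rw [← h1, Matrix.mul_apply]
  refine (norm_sum_le _ _).trans ?_
  calc ∑ k, ‖sqrtMat ρ i k * sqrtMat ρ k j‖ ≤ ∑ _k : Fin 3, (1 : ℝ) := by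
        refine Finset.sum_le_sum fun k _ => ?_
        rw [norm_mul]
        exact mul_le_one₀ (hle i k) (norm_nonneg _) (hle k j)
    _ = 3 := by simp

/-- Relations between the matrix elements of a density matrix. -/
theorem IsDensity.apply_eq {ρ : Mat3} (hρ : IsDensity ρ) :
    ρ 0 0 = (ρ 0 0).re ∧ ρ 1 1 + ρ 2 2 = 1 - (ρ 0 0).re ∧ ρ 1 2 + ρ 2 1 = 2 * (ρ 1 2).re := by
  have h1 : ρ 0 0 = (ρ 0 0).re := (Complex.conj_eq_iff_re.1 (hρ.1.isHermitian.apply 0 0)).symm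
  have h2 := hρ.2
  rw [Matrix.trace_fin_three, h1] at h2
  refine ⟨h1, by linear_combination h2, ?_⟩
  rw [← hρ.1.isHermitian.apply 2 1]
  exact_mod_cast Complex.add_conj (ρ 1 2)

/-- The weight `1 + ρ₁₁ + 2 Re ρ₂₃` of the final state, divided by two. -/
def finalWeight (ρ : Mat3) : ℝ := (1 + (ρ 0 0).re + 2 * (ρ 1 2).re) / 2

/-- w is the bright population and 1 - w the dark one; both are nonnegative by testing ρ on `upper`,
`symm` and `anti`. -/
theorem IsDensity.finalWeight_mem {ρ : Mat3} (hρ : IsDensity ρ) :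
    finalWeight ρ ∈ Set.Icc (0 : ℝ) 1 := by
  obtain ⟨-, h2, h3⟩ := hρ.apply_eq
  have h2' := congrArg Complex.re h2
  have h3' := congrArg Complex.re h3
  have e1 := (Complex.le_def.1 (hρ.1.dotProduct_mulVec_nonneg upper)).1
  have e2 := (Complex.le_def.1 (hρ.1.dotProduct_mulVec_nonneg symm)).1
  have e3 := (Complex.le_def.1 (hρ.1.dotProduct_mulVec_nonneg anti)).1
  simp [dotProduct, Matrix.mulVec, Fin.sum_univ_three, upper, symm, anti] at e1 e2 e3 h2' h3'
  rw [finalWeight]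
  constructor <;> linarith

/-- Spectral decomposition along `upper`, `symm` and `anti`, with eigenvalues p and (1 - p)/2 ± α;
the extra halves normalize vectors of squared length 2. -/
theorem blockMat_posSemidef {p α : ℝ} (hp : 0 ≤ p) (h1 : 0 ≤ (1 - p) / 2 + α)
    (h2 : 0 ≤ (1 - p) / 2 - α) : (blockMat p α).PosSemidef := by
  have h : blockMat p α = (p : ℂ) • Matrix.vecMulVec upper (star upper) +
      ((((1 - p) / 2 + α) / 2 : ℝ) : ℂ) • Matrix.vecMulVec symm (star symm) +
      ((((1 - p) / 2 - α) / 2 : ℝ) : ℂ) • Matrix.vecMulVec anti (star anti) := by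
    ext i j
    simp only [Matrix.add_apply, Matrix.smul_apply, Matrix.vecMulVec_apply, Pi.star_apply]
    fin_cases i <;> fin_cases j <;> simp [blockMat, upper, symm, anti] <;> ring
  have hc : ∀ {x : ℝ}, 0 ≤ x → (0 : ℂ) ≤ x := fun hx => by exact_mod_cast hx
  rw [h]
  exact (((Matrix.posSemidef_vecMulVec_self_star _).smul (hc hp)).add
    ((Matrix.posSemidef_vecMulVec_self_star _).smul (hc (by linarith)))).add
    ((Matrix.posSemidef_vecMulVec_self_star _).smul (hc (by linarith)))

/-- Coefficient of the state `ρ` along a mode. -/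
def modeCoeff (η : ℝ) (ρ : Mat3) (j : Fin 3) (s : Fin (mult j)) : ℂ :=
  ∑ q, ρ q.2 q.1 * modeRight η j s q

theorem IsDensity.norm_modeCoeff_le {η : ℝ} (h0 : 0 ≤ η) (h1 : η ≤ 1) {ρ : Mat3}
    (hρ : IsDensity ρ) (j : Fin 3) (s : Fin (mult j)) : ‖modeCoeff η ρ j s‖ ≤ 27 := by
  refine (norm_sum_le _ _).trans ?_
  calc ∑ q, ‖ρ q.2 q.1 * modeRight η j s q‖ ≤ ∑ _q : Fin 3 × Fin 3, (3 : ℝ) * 1 := by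
        refine Finset.sum_le_sum fun q _ => ?_
        rw [norm_mul]
        exact mul_le_mul (hρ.norm_apply_le _ _) (norm_modeRight_le h0 h1 j s q) (norm_nonneg _)
          (by norm_num)
    _ = 27 := by
        simp
        norm_num

namespace Model

variable (M : Model)

theorem pInf_eq (ρ : Mat3) : M.pInf ρ = M.weight * finalWeight ρ := by
  have := Real.exp_pos (M.β * M.gap)
  rw [pInf, weight, finalWeight]
  field_simp

theorem alphaOf_pInf (ρ : Mat3) :
    M.alphaOf (M.pInf ρ) = ((2 - M.weight) * finalWeight ρ - 1) / 2 := by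
  have := Real.exp_pos (M.β * M.gap)
  rw [pInf_eq, alphaOf, weight]
  field_simp
  ring

/-- The eigenvalues of the final state are ηw, (1 - η)w and 1 - w. -/
theorem finalState_mem (hβ : 0 < M.β) (hΔ : 0 < M.gap) {ρ : Mat3} (hρ : IsDensity ρ) :
    IsDensity (M.finalState ρ) ∧ M.finalState ρ ∈ M.quasiStationary := by
  obtain ⟨h0, h1⟩ := hρ.finalWeight_mem
  have hw := M.weight_pos
  have hw' := M.weight_le_half hβ hΔ
  refine ⟨⟨?_, ?_⟩, M.pInf ρ, ⟨?_, ?_⟩, rfl⟩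
  · refine blockMat_posSemidef ?_ ?_ ?_
    · rw [pInf_eq]
      positivity
    · rw [alphaOf_pInf, pInf_eq]
      nlinarith
    · rw [alphaOf_pInf, pInf_eq]
      nlinarith
  · rw [finalState, blockMat, Matrix.trace_fin_three]
    simp
    ring
  · rw [pInf_eq]
    positivity
  · rw [pInf_eq, one_div, ← weight]
    nlinarith

/-- The final state has the same bright population as ρ, and it depends on nothing else. -/
theorem finalState_finalState (ρ : Mat3) : M.finalState (M.finalState ρ) = M.finalState ρ := by
  have h : finalWeight (M.finalState ρ) = finalWeight ρ := by
    have h1 : finalWeight (M.finalState ρ) =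
        (1 + M.pInf ρ + 2 * M.alphaOf (M.pInf ρ)) / 2 := by
      simp [finalWeight, finalState, blockMat]
    rw [h1, alphaOf_pInf, pInf_eq]
    ring
  rw [finalState, pInf_eq, h, ← pInf_eq]
  rfl

/-- The coefficients of the two stationary modes are w and 1 - w; their left eigenvectors are the
bright Gibbs state and the dark state. -/
theorem finalState_apply {ρ : Mat3} (hρ : IsDensity ρ) (k l : Fin 3) :
    M.finalState ρ k l =
      modeCoeff M.weight ρ 0 (0 : Fin 5) * modeLeft M.weight 0 (0 : Fin 5) (l, k) +
      modeCoeff M.weight ρ 0 (1 : Fin 5) * modeLeft M.weight 0 (1 : Fin 5) (l, k) := by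
  obtain ⟨h1, h2, h3⟩ := hρ.apply_eq
  have c0 : modeCoeff M.weight ρ 0 (0 : Fin 5) = finalWeight ρ := by
    change ∑ q, ρ q.2 q.1 * rightDiag M.weight 0 q = _
    simp [Fintype.sum_prod_type, Fin.sum_univ_three, rightDiag, tens, upper, symm, finalWeight]
    linear_combination h1 + h2 / 2 + h3 / 2
  have c1 : modeCoeff M.weight ρ 0 (1 : Fin 5) = 1 - finalWeight ρ := by
    change ∑ q, ρ q.2 q.1 * rightDiag M.weight 1 q = _
    simp [Fintype.sum_prod_type, Fin.sum_univ_three, rightDiag, tens, anti, finalWeight]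
    linear_combination h2 / 2 - h3 / 2
  rw [c0, c1]
  change M.finalState ρ k l = _ * leftDiag M.weight 0 (l, k) + _ * leftDiag M.weight 1 (l, k)
  rw [finalState, alphaOf_pInf, pInf_eq]
  fin_cases k <;> fin_cases l <;>
    simp [blockMat, leftDiag, tens, upper, symm, anti] <;> ring

/-- The invariant states have no component along the decaying modes. -/
theorem modeCoeff_finalState (ρ : Mat3) :
    (∀ s : Fin 5, 2 ≤ s → modeCoeff M.weight (M.finalState ρ) 0 s = 0) ∧
    (∀ s, modeCoeff M.weight (M.finalState ρ) 1 s = 0) ∧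
    ∀ s, modeCoeff M.weight (M.finalState ρ) 2 s = 0 := by
  rw [finalState, alphaOf_pInf, pInf_eq]
  refine ⟨fun s hs => ?_, ?_, ?_⟩
  · change ∑ q, _ * rightDiag M.weight s q = _
    fin_cases s <;> simp at hs <;>
      simp [Fintype.sum_prod_type, Fin.sum_univ_three, rightDiag, tens, upper, symm, anti,
        blockMat]
    ring
  · intro s
    change Fin 2 at s
    change ∑ q, _ * rightUp s q = _
    fin_cases s <;>
      simp [Fintype.sum_prod_type, Fin.sum_univ_three, rightUp, tens, upper, symm, anti, blockMat]
  · intro s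
    change Fin 2 at s
    change ∑ q, _ * rightDown s q = _
    fin_cases s <;>
      simp [Fintype.sum_prod_type, Fin.sum_univ_three, rightDown, tens, upper, symm, anti, blockMat]

end Model
end ThreeLevel

end
-- Exponential decay to the final state
noncomputable section

namespace ThreeLevel

namespace Model

variable (M : Model)

/-- Contribution of a mode to the matrix elements of the evolved state. -/
def modeTerm (lam : ℝ) (X Y : ℂ) (t : ℝ) (ρ : Mat3) (k l : Fin 3) (j : Fin 3)
    (s : Fin (mult j)) : ℂ :=
  Complex.exp (Complex.I * t * (M.bohr j + modeShift lam X Y j s)) *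
    (modeCoeff M.weight ρ j s * modeLeft M.weight j s (l, k))

namespace Resonances

variable {M} {lam : ℝ}

/-- The projections act on observables: right eigenvectors are tested against ρ, and left
eigenvectors supply the matrix elements of the evolved state. The order (l, k) comes from the
observable |φ_l⟩⟨φ_k|. -/
theorem approxDynamics_apply (hΔ : 0 < M.gap) {X Y : ℂ}
    (h : ∀ j, M.levelShift 0 lam j = M.levelShiftMat lam X Y j) (D : M.Resonances 0 lam) (t : ℝ)
    {ρ : Mat3} (hρ : ρ.PosSemidef) (k l : Fin 3) :
    D.approxDynamics t ρ k l = ∑ j, ∑ s, M.modeTerm lam X Y t ρ k l j s := by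
  change D.expectation t ρ (Matrix.single l k 1) = _
  rw [D.expectation_eq t hρ]
  refine Finset.sum_congr rfl fun j _ => ?_
  rw [D.sum_smul_proj_eq (M.resonancesOfBoundary hΔ lam h)
    (fun z => Complex.exp (Complex.I * t * z)) j]
  have hv : (fun q : Fin 3 × Fin 3 => (Matrix.single l k (1 : ℂ)) q.1 q.2) =
      Pi.single (l, k) 1 := by
    ext ⟨a, b⟩
    simp only [Matrix.single_apply, Pi.single_apply, Prod.mk.injEq, eq_comm]
  rw [hv]
  simp only [Matrix.mulVec_single_one, Matrix.col_apply, Matrix.sum_apply, Matrix.smul_apply,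
    resonancesOfBoundary, Matrix.vecMulVec_apply, smul_eq_mul, modeTerm, modeCoeff,
    Finset.mul_sum, Finset.sum_mul]
  rw [Finset.sum_comm]
  refine Finset.sum_congr rfl fun s _ => Finset.sum_congr rfl fun q _ => ?_
  ring

theorem approxDynamics_sub_apply (hΔ : 0 < M.gap) {X Y : ℂ}
    (h : ∀ j, M.levelShift 0 lam j = M.levelShiftMat lam X Y j) (D : M.Resonances 0 lam) (t : ℝ)
    {ρ : Mat3} (hρ : IsDensity ρ) (k l : Fin 3) :
    (D.approxDynamics t ρ - M.finalState ρ) k l =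
      (M.modeTerm lam X Y t ρ k l 0 (2 : Fin 5) + M.modeTerm lam X Y t ρ k l 0 (3 : Fin 5) +
        M.modeTerm lam X Y t ρ k l 0 (4 : Fin 5)) +
      ∑ s, M.modeTerm lam X Y t ρ k l 1 s + ∑ s, M.modeTerm lam X Y t ρ k l 2 s := by
  rw [Matrix.sub_apply, D.approxDynamics_apply hΔ h t hρ.1, M.finalState_apply hρ,
    Fin.sum_univ_three, sum_mult_zero]
  have e0 : M.modeTerm lam X Y t ρ k l 0 (0 : Fin 5) =
      modeCoeff M.weight ρ 0 (0 : Fin 5) * modeLeft M.weight 0 (0 : Fin 5) (l, k) := by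
    have : modeShift lam X Y 0 (0 : Fin 5) = 0 := rfl
    simp [modeTerm, this, bohr]
  have e1 : M.modeTerm lam X Y t ρ k l 0 (1 : Fin 5) =
      modeCoeff M.weight ρ 0 (1 : Fin 5) * modeLeft M.weight 0 (1 : Fin 5) (l, k) := by
    have : modeShift lam X Y 0 (1 : Fin 5) = 0 := rfl
    simp [modeTerm, this, bohr]
  rw [e0, e1]
  ring

end Resonances

theorem norm_modeTerm_le (hβ : 0 < M.β) (hΔ : 0 < M.gap) {lam : ℝ} {X Y : ℂ} {c t : ℝ}
    (ht : 0 ≤ t) {ρ : Mat3} (hρ : IsDensity ρ) (k l j : Fin 3) (s : Fin (mult j))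
    (hs : c * lam ^ 2 ≤ (modeShift lam X Y j s).im) :
    ‖M.modeTerm lam X Y t ρ k l j s‖ ≤ 27 * Real.exp (-c * lam ^ 2 * t) := by
  have h0 := M.weight_pos.le
  have h1 : M.weight ≤ 1 := (M.weight_le_half hβ hΔ).trans (by norm_num)
  rw [modeTerm, norm_mul, norm_mul, Complex.norm_exp, mul_comm (27 : ℝ)]
  refine mul_le_mul (Real.exp_le_exp.2 ?_) ?_ (by positivity) (Real.exp_pos _).le
  · simp
    nlinarith
  · calc _ ≤ (27 : ℝ) * 1 := mul_le_mul (hρ.norm_modeCoeff_le h0 h1 j s)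
          (norm_modeLeft_le h0 h1 j s _) (norm_nonneg _) (by norm_num)
      _ = 27 := by norm_num

/-- The decay rates of the non-stationary modes. -/
theorem le_im_modeShift {X Y : ℂ} {c : ℝ} (hX : X.im ≤ -c) (hY : Y.im ≤ -c) (hc : 0 ≤ c)
    (lam : ℝ) :
    (∀ s : Fin 5, 2 ≤ s → c * lam ^ 2 ≤ (modeShift lam X Y 0 s).im) ∧
    (∀ s, c * lam ^ 2 ≤ (modeShift lam X Y 1 s).im) ∧
    ∀ s, c * lam ^ 2 ≤ (modeShift lam X Y 2 s).im := by
  have hre : ((lam : ℂ) ^ 2).re = lam ^ 2 := by rw [← Complex.ofReal_pow, Complex.ofReal_re]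
  have him : ((lam : ℂ) ^ 2).im = 0 := by rw [← Complex.ofReal_pow, Complex.ofReal_im]
  have h0 := sq_nonneg lam
  refine ⟨fun s hs => ?_, fun s => ?_, fun s => ?_⟩
  · change _ ≤ (energyDiag lam X Y s).im
    fin_cases s <;> simp at hs <;> simp [energyDiag, hre, him] <;> nlinarith
  · change Fin 2 at s
    change _ ≤ (energyUp lam X Y s).im
    fin_cases s <;> simp [energyUp, hre, him] <;> nlinarith
  · change Fin 2 at s
    change _ ≤ (energyDown lam X Y s).im
    fin_cases s <;> simp [energyDown, hre, him] <;> nlinarith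

/-- Existence of the level shift operators, with boundary values which decay at a uniform rate. -/
theorem exists_boundary (hβ : 0 < M.β) (hΔ : 0 < M.gap)
    (hg : MemLp M.g 2 (volume : Measure Momentum))
    (hIR : Integrable (fun k : Momentum => ‖M.g k‖ ^ 2 / ‖k‖) volume)
    (hreg : ContDiffAt ℝ 1 M.spectralDensity M.gap)
    (hJ : 0 < M.spectralDensity M.gap) :
    ∃ X Y : ℂ, ∃ c : ℝ, 0 < c ∧ X.im ≤ -c ∧ Y.im ≤ -c ∧ ∀ lam j,
      Tendsto (M.regLevelShift 0 lam j) (𝓝[>] 0) (𝓝 (M.levelShiftMat lam X Y j)) := by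
  obtain ⟨A₁, A₂, hX, hY⟩ := M.exists_tendsto_resonanceIntegral hβ hΔ hg hIR hreg
  have hT := M.width_pos hβ hΔ hJ
  have hw := M.weight_pos
  have hw' := M.weight_le_half hβ hΔ
  -- The rate is c = ηT; as η ≤ 1/2, it is the smaller of ηT and (1 - η)T.
  refine ⟨_, _, M.weight * M.width, by positivity, ?_, ?_, fun lam j =>
    M.tendsto_regLevelShift hΔ lam hX hY ?_ ?_ j⟩
  · simp
    nlinarith
  · simp
  · simp
    ring
  · simp
    ring

theorem levelShift_eq_of_tendsto {lam : ℝ} {j : Fin 3} {Λ : Mat9}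
    (h : Tendsto (M.regLevelShift 0 lam j) (𝓝[>] 0) (𝓝 Λ)) : M.levelShift 0 lam j = Λ :=
  h.limUnder_eq

theorem norm_approxDynamics_sub_apply_le (hβ : 0 < M.β) (hΔ : 0 < M.gap) {X Y : ℂ} {c : ℝ}
    (hc : 0 < c) (hX : X.im ≤ -c) (hY : Y.im ≤ -c) {lam : ℝ}
    (h : ∀ j, M.levelShift 0 lam j = M.levelShiftMat lam X Y j) (D : M.Resonances 0 lam)
    {ρ : Mat3} (hρ : IsDensity ρ) {t : ℝ} (ht : 0 ≤ t) (k l : Fin 3) :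
    ‖(D.approxDynamics t ρ - M.finalState ρ) k l‖ ≤ 189 * Real.exp (-c * lam ^ 2 * t) := by
  obtain ⟨h0, h1, h2⟩ := le_im_modeShift hX hY hc.le lam
  have b : ∀ j s, c * lam ^ 2 ≤ (modeShift lam X Y j s).im →
      ‖M.modeTerm lam X Y t ρ k l j s‖ ≤ 27 * Real.exp (-c * lam ^ 2 * t) :=
    fun j s hs => M.norm_modeTerm_le hβ hΔ ht hρ k l j s hs
  rw [D.approxDynamics_sub_apply hΔ h t hρ, sum_mult_one, sum_mult_two]
  -- Seven decaying modes, three in sector 0 and two in each other sector, with bound 27 each: 189 =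
  -- 7 · 27.
  refine (norm_add_le_of_le (norm_add_le_of_le (norm_add_le_of_le
    (norm_add_le_of_le (b 0 (2 : Fin 5) (h0 _ ?_)) (b 0 (3 : Fin 5) (h0 _ ?_)))
    (b 0 (4 : Fin 5) (h0 _ ?_)))
    (norm_add_le_of_le (b _ _ (h1 _)) (b _ _ (h1 _))))
    (norm_add_le_of_le (b _ _ (h2 _)) (b _ _ (h2 _)))).trans (le_of_eq (by ring)) <;> decide

theorem approxDynamics_finalState (hβ : 0 < M.β) (hΔ : 0 < M.gap) {X Y : ℂ} {lam : ℝ}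
    (h : ∀ j, M.levelShift 0 lam j = M.levelShiftMat lam X Y j) (D : M.Resonances 0 lam)
    {ρ : Mat3} (hρ : IsDensity ρ) (t : ℝ) :
    D.approxDynamics t (M.finalState ρ) = M.finalState ρ := by
  obtain ⟨h0, h1, h2⟩ := M.modeCoeff_finalState ρ
  have b : ∀ k l j s, modeCoeff M.weight (M.finalState ρ) j s = 0 →
      M.modeTerm lam X Y t (M.finalState ρ) k l j s = 0 := fun k l j s hs => by
    simp [modeTerm, hs]
  have hsub : D.approxDynamics t (M.finalState ρ) - M.finalState (M.finalState ρ) = 0 := by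
    ext k l
    rw [D.approxDynamics_sub_apply hΔ h t (M.finalState_mem hβ hΔ hρ).1,
      b k l 0 (2 : Fin 5) (h0 _ (by decide)), b k l 0 (3 : Fin 5) (h0 _ (by decide)),
      b k l 0 (4 : Fin 5) (h0 _ (by decide)),
      Finset.sum_eq_zero fun s _ => b k l 1 s (h1 s),
      Finset.sum_eq_zero fun s _ => b k l 2 s (h2 s)]
    simp
  rw [sub_eq_zero.1 hsub, finalState_finalState]

end Model

end ThreeLevel

end

theorem proposition2 (M : Model) (hβ : 0 < M.β) (hΔ : 0 < M.gap)
    (hg : MemLp M.g 2 (volume : Measure Momentum))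
    (hIR : Integrable (fun k : Momentum => ‖M.g k‖ ^ 2 / ‖k‖) volume)
    (hreg : ContDiffAt ℝ 1 M.spectralDensity M.gap)
    (hJ : 0 < M.spectralDensity M.gap) :
    -- for `σ = 0`: the level shift operators exist and are diagonalizable
    (∀ lam : ℝ, lam ≠ 0 →
      (∀ j, Tendsto (M.regLevelShift 0 lam j) (𝓝[>] 0) (𝓝 (M.levelShift 0 lam j))) ∧
      Nonempty (M.Resonances 0 lam)) ∧
    -- convergence to the final state, which is an invariant state
    (∀ ρ₀ : Mat3, IsDensity ρ₀ →
      IsDensity (M.finalState ρ₀) ∧ M.finalState ρ₀ ∈ M.quasiStationary ∧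
      ∀ lam : ℝ, lam ≠ 0 → ∀ D : M.Resonances 0 lam,
        Tendsto (fun t : ℝ => D.approxDynamics t ρ₀) atTop (𝓝 (M.finalState ρ₀)) ∧
        ∀ t : ℝ, 0 ≤ t → D.approxDynamics t (M.finalState ρ₀) = M.finalState ρ₀) ∧
    -- exponential speed of convergence, with constants that do not depend on `lam`
    (∃ C c : ℝ, 0 < c ∧ ∀ lam : ℝ, lam ≠ 0 → ∀ D : M.Resonances 0 lam,
      ∀ ρ₀ : Mat3, IsDensity ρ₀ → ∀ t : ℝ, 0 ≤ t →
        traceNorm (D.approxDynamics t ρ₀ - M.finalState ρ₀) ≤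
          C * Real.exp (-c * lam ^ 2 * t)) := by
  obtain ⟨X, Y, c, hc, hX, hY, hlim⟩ := M.exists_boundary hβ hΔ hg hIR hreg hJ
  have hΛ : ∀ lam j, M.levelShift 0 lam j = M.levelShiftMat lam X Y j := fun lam j =>
    M.levelShift_eq_of_tendsto (hlim lam j)
  refine ⟨fun lam _ => ⟨fun j => ?_, ⟨M.resonancesOfBoundary hΔ lam (hΛ lam)⟩⟩,
    fun ρ₀ hρ => ⟨(M.finalState_mem hβ hΔ hρ).1, (M.finalState_mem hβ hΔ hρ).2,
      fun lam hlam D => ⟨?_, fun t _ => M.approxDynamics_finalState hβ hΔ (hΛ lam) D hρ t⟩⟩,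
    -- 5103 = 3 · 9 · 189, from `traceNorm_le` and nine matrix entries bounded by 189 times the
    -- exponential.
    5103, c, hc, fun lam _ D ρ₀ hρ t ht => ?_⟩
  · rw [hΛ]
    exact hlim lam j
  · refine tendsto_pi_nhds.2 fun k => tendsto_pi_nhds.2 fun l => ?_
    rw [tendsto_iff_norm_sub_tendsto_zero]
    have hexp : Tendsto (fun t : ℝ => 189 * Real.exp (-c * lam ^ 2 * t)) atTop (𝓝 0) := by
      have h1 : 0 < c * lam ^ 2 := by positivity
      have h2 : Tendsto (fun t : ℝ => -c * lam ^ 2 * t) atTop atBot := by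
        simp only [neg_mul]
        exact tendsto_neg_atTop_atBot.comp (tendsto_id.const_mul_atTop h1)
      simpa using (Real.tendsto_exp_atBot.comp h2).const_mul 189
    refine squeeze_zero' (Eventually.of_forall fun t => norm_nonneg _) ?_ hexp
    filter_upwards [eventually_ge_atTop 0] with t ht
    exact M.norm_approxDynamics_sub_apply_le hβ hΔ hc hX hY (hΛ lam) D hρ ht k l
  · calc traceNorm (D.approxDynamics t ρ₀ - M.finalState ρ₀)
        ≤ 3 * ∑ k, ∑ l, ‖(D.approxDynamics t ρ₀ - M.finalState ρ₀) k l‖ := traceNorm_le _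
      _ ≤ 3 * ∑ _k : Fin 3, ∑ _l : Fin 3, 189 * Real.exp (-c * lam ^ 2 * t) := by
          gcongr with k _ l _
          exact M.norm_approxDynamics_sub_apply_le hβ hΔ hc hX hY (hΛ lam) D hρ ht k l
      _ = 5103 * Real.exp (-c * lam ^ 2 * t) := by
          simp
          ring
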